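/- All graphs are finite, simple and undirected. For a connected graph $G$ and a nonempty set $S\subseteq V(G)$, the Steiner distance $d_G(S)$ is the minimum number of edges of a connected subgraph of $G$ whose vertex set contains $S$. For $v\in V(G)$ let $e_k(v)=\max\{d_G(S) : S\subseteq V(G),\ |S|=k,\ v\in S\}$, and let $\mathrm{sdiam}_k(G)=\max\{e_k(v) : v\in V(G)\}$. The length of a path is its number of edges; a path of length $0$ is a single vertex. To attach a path at a vertex $x$ means to identify one endvertex of the path with $x$. **Theorem.** Let $G$ be a connected graph of order $n\ge 5$. Then $\mathrm{sdiam}_4(G)=n-1$ if and only if $G$ is isomorphic, for some integers $a,b,c,d\ge 0$, to one of the following graphs of order $n$: 1. $T_{a,b,c,d}$, where $a+b+c+d\le n-1$: the tree obtained from a path $v_1v_2\cdots v_{n-b-c}$ by attaching a path of length $b$ at $v_{a+1}$ and a path of length $c$ at $v_{n-b-c-d}$ (these two vertices may coincide); 2. $\triangle_{a,b,c,d}$, where $a+b+c+d\le n-3$: the unicyclic graph obtained from a path $v_1v_2\cdots v_{n-b-c-1}$ by attaching a path of length $b+1$ at $v_{a+1}$ and a path of length $c$ at $v_{n-b-c-d-1}$,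 and then adding the edge joining $v_{a+2}$ to the neighbour of $v_{a+1}$ on the attached path of length $b+1$ (the vertices $v_{a+2}$ and $v_{n-b-c-d-1}$ may coincide); 3. $\triangle'_{a,b,c,d}$, where $a+b+c+d\le n-5$: the bicyclic graph obtained from a path $v_1v_2\cdots v_{n-b-c-2}$ by attaching a path of length $b+1$ at $v_{a+1}$ and a path of length $c+1$ at $v_{n-b-c-d-2}$, and then adding the edge joining $v_{a+2}$ to the neighbour of $v_{a+1}$ on the attached path of length $b+1$, and the edge joining $v_{n-b-c-d-3}$ to the neighbour of $v_{n-b-c-d-2}$ on the attached path of length $c+1$ (the vertices $v_{a+2}$ and $v_{n-b-c-d-3}$ may coincide); 4. $G_1$, where $a+b+c+d=n-4$: a complete graph $K_4$ with four paths of lengths $a,b,c,d$ attached, one at each of its vertices; 5. $G_2$, where $a+b+c+d=n-4$: a cycle $C_4$ with four paths of lengths $a,b,c,d$ attached, one at each of its vertices; 6. $G_3$, where $a+b+c+d=n-4$: the graph $K_4^-$, obtained from $K_4$ by deleting one edge, with four paths of lengths $a,b,c,d$ attached, one at each of its vertices. -/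

import Mathlib

/-- The Steiner distance of `S` in `G`: the minimum number of edges of a connected subgraph of `G`
whose vertex set contains `S` (and `⊤` if there is no such subgraph). -/
noncomputable def steinerDist {V : Type*} (G : SimpleGraph V) (S : Finset V) : ℕ∞ :=
  ⨅ (H : G.Subgraph) (_ : H.Connected) (_ : (S : Set V) ⊆ H.verts), H.edgeSet.encard

/-- The Steiner `k`-eccentricity of `v`: the maximum Steiner distance of a `k`-element set of
vertices that contains `v`. -/
noncomputable def steinerEcc {V : Type*} (G : SimpleGraph V) (k : ℕ) (v : V) : ℕ∞ :=
  ⨆ (S : Finset V) (_ : S.card = k) (_ : v ∈ S), steinerDist G S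

/-- The Steiner `k`-diameter of `G`: the maximum Steiner `k`-eccentricity of a vertex. -/
noncomputable def sdiam {V : Type*} (G : SimpleGraph V) (k : ℕ) : ℕ∞ :=
  ⨆ v : V, steinerEcc G k v

/-- The graph obtained from `H` and, for each `i : ι`, a path of length `ℓ i`, by identifying an
endvertex of the `i`-th path with the vertex `p i` of `H`. The vertex `Sum.inr ⟨i, j⟩` is the vertex
at distance `j + 1` from the identified endvertex on the `i`-th path. -/
def attachPaths {B ι : Type} (H : SimpleGraph B) (p : ι → B) (ℓ : ι → ℕ) :
    SimpleGraph (B ⊕ (Σ i : ι, Fin (ℓ i))) where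
  Adj
    | Sum.inl x, Sum.inl y => H.Adj x y
    | Sum.inl x, Sum.inr ⟨i, j⟩ => x = p i ∧ j.val = 0
    | Sum.inr ⟨i, j⟩, Sum.inl x => x = p i ∧ j.val = 0
    | Sum.inr ⟨i, j⟩, Sum.inr ⟨i', j'⟩ =>
        i = i' ∧ (j.val + 1 = j'.val ∨ j'.val + 1 = j.val)
  symm := ⟨by
    rintro (x | ⟨i, j⟩) (y | ⟨i', j'⟩) h
    · exact SimpleGraph.Adj.symm h
    · exact h
    · exact h
    · exact ⟨h.1.symm, h.2.symm⟩⟩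
  loopless := ⟨by
    rintro (x | ⟨i, j⟩) h
    · exact H.irrefl h
    · have h2 := h.2
      omega⟩

/-- The tree `T_{a,b,c,d}` of order `n`: a path with `n - b - c` vertices, with a path of length `b`
attached at its `(a+1)`-th vertex and a path of length `c` attached at its `(n-b-c-d)`-th vertex. -/
def treeGraph (n a b c d : ℕ) (h : a + b + c + d + 1 ≤ n) :
    SimpleGraph (Fin (n - b - c) ⊕ (Σ i : Fin 2, Fin (![b, c] i))) :=
  attachPaths (SimpleGraph.pathGraph (n - b - c))
    ![⟨a, by omega⟩, ⟨n - b - c - d - 1, by omega⟩] ![b, c]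

/-- The unicyclic graph `△_{a,b,c,d}` of order `n`: a path `v₁ v₂ …` with `n - b - c - 1` vertices,
with a path of length `b + 1` attached at `v_{a+1}` and a path of length `c` attached at
`v_{n-b-c-d-1}`, together with the edge joining `v_{a+2}` to the neighbour of `v_{a+1}` on the
attached path of length `b + 1`. -/
def triangleGraph (n a b c d : ℕ) (h : a + b + c + d + 3 ≤ n) :
    SimpleGraph (Fin (n - b - c - 1) ⊕ (Σ i : Fin 2, Fin (![b + 1, c] i))) :=
  attachPaths (SimpleGraph.pathGraph (n - b - c - 1))
      ![⟨a, by omega⟩, ⟨n - b - c - d - 2, by omega⟩] ![b + 1, c] ⊔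
    SimpleGraph.edge (Sum.inl ⟨a + 1, by omega⟩) (Sum.inr ⟨0, (0 : Fin (b + 1))⟩)

/-- The bicyclic graph `△'_{a,b,c,d}` of order `n`: a path `v₁ v₂ …` with `n - b - c - 2` vertices,
with a path of length `b + 1` attached at `v_{a+1}` and a path of length `c + 1` attached at
`v_{n-b-c-d-2}`, together with the edge joining `v_{a+2}` to the neighbour of `v_{a+1}` on the first
attached path and the edge joining `v_{n-b-c-d-3}` to the neighbour of `v_{n-b-c-d-2}` on the second
attached path. -/
def triangleGraph' (n a b c d : ℕ) (h : a + b + c + d + 5 ≤ n) :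
    SimpleGraph (Fin (n - b - c - 2) ⊕ (Σ i : Fin 2, Fin (![b + 1, c + 1] i))) :=
  attachPaths (SimpleGraph.pathGraph (n - b - c - 2))
      ![⟨a, by omega⟩, ⟨n - b - c - d - 3, by omega⟩] ![b + 1, c + 1] ⊔
    SimpleGraph.edge (Sum.inl ⟨a + 1, by omega⟩) (Sum.inr ⟨0, (0 : Fin (b + 1))⟩) ⊔
    SimpleGraph.edge (Sum.inl ⟨n - b - c - d - 4, by omega⟩) (Sum.inr ⟨1, (0 : Fin (c + 1))⟩)

/-- `K_4` with one edge deleted. -/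
def K4minus : SimpleGraph (Fin 4) :=
  (⊤ : SimpleGraph (Fin 4)).deleteEdges {s(0, 1)}

/-- A graph `H` on four vertices, with paths of lengths `a, b, c, d` attached at its vertices, one at
each vertex. -/
def fourPaths (H : SimpleGraph (Fin 4)) (a b c d : ℕ) :
    SimpleGraph (Fin 4 ⊕ (Σ i : Fin 4, Fin (![a, b, c, d] i))) :=
  attachPaths H id ![a, b, c, d]

/-!
A connected vertex set `W` is spanned by a tree with `|W| - 1` edges, so the Steiner `4`-diameter is
`n - 1` exactly when some four-element set `S` lies in no proper connected vertex set
(`sdiam_eq_iff`).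

Given such an `S`, take a shortest path `P` between two of its elements, a shortest path `Q` from a
third element to `P`, and a shortest path `R` from the fourth to `P ∪ Q`. The union is connected and
contains `S`, so it is all of `G` (`exists_threePaths_model`). Hence `G` consists of at most three
induced paths, and it only remains to know the set `N₁` of neighbours on `P` of the first vertex of
`Q`, and the set `N₂` of neighbours on `P ∪ Q` of the first vertex of `R`. As `P` is a shortest path,
`N₁` lies in a window of three consecutive vertices. Moreover every vertex outside `S`, that is, every
vertex that is not an end of one of the paths, is a cut vertex, which leaves few choices for `N₂`: a
vertex bypassed by `R` would usually not be a cut vertex (`IsCutLabel.of_bypass`,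
`not_isCutLabel_of_bypass`, `not_isCutLabel_of_separates`, `IsCutLabel.eq_of_second_path`). The
remaining configurations are the graphs of the list (`isListed_of_model`).

Conversely, in each listed graph the at most four ends of the paths are separated from each other by
every other vertex, so a connected set containing them contains all vertices
(`IsListed.exists_card_four`).

To make the isomorphisms a matter of linear arithmetic, all graphs are described by labellings of
their vertices with `0, …, n - 1` and a relation between labels (`HasModel`): consecutive intervals of
labels are the paths, and `T`, `△`, `△'` are the cases where `N₁` and `N₂` consist of one vertex or two
consecutive vertices of `P`.
-/

/-! ### Steiner diameter and connected vertex sets -/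

/-- In a connected induced subgraph, a property that passes along edges passes between any two
vertices. -/
theorem SimpleGraph.Preconnected.induce_prop {V : Type*} {G : SimpleGraph V} {W : Set V}
    (h : (G.induce W).Preconnected) {c : V → Prop}
    (hc : ∀ u ∈ W, ∀ v ∈ W, G.Adj u v → c u → c v) {u v : V} (hu : u ∈ W) (hv : v ∈ W)
    (huc : c u) : c v := by
  obtain ⟨w⟩ := h ⟨u, hu⟩ ⟨v, hv⟩
  have key : ∀ (x y : W) (_ : (G.induce W).Walk x y), c x → c y := by
    intro x y p
    induction p with
    | nil => exact id
    | cons hadj _ ih => exact fun hx => ih (hc _ (Subtype.coe_prop _) _ (Subtype.coe_prop _) hadj hx)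
  exact key _ _ w huc

/-- A vertex set induces a connected subgraph as soon as every property that passes along its edges
passes between any two of its vertices. -/
theorem SimpleGraph.preconnected_induce_of_prop {V : Type*} {G : SimpleGraph V} {W : Set V}
    (h : ∀ c : V → Prop, (∀ u ∈ W, ∀ v ∈ W, G.Adj u v → (c u ↔ c v)) →
      ∀ u ∈ W, ∀ v ∈ W, c u ↔ c v) :
    (G.induce W).Preconnected := by
  rintro ⟨u, hu⟩ ⟨v, hv⟩
  have := h (fun x => ∃ hx : x ∈ W, (G.induce W).Reachable ⟨u, hu⟩ ⟨x, hx⟩) (by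
    intro x hx y hy hxy
    have hadj : (G.induce W).Adj ⟨x, hx⟩ ⟨y, hy⟩ := hxy
    exact ⟨fun ⟨_, h⟩ => ⟨hy, h.trans hadj.reachable⟩,
      fun ⟨_, h⟩ => ⟨hx, h.trans hadj.symm.reachable⟩⟩) u hu v hv
  exact (this.1 ⟨hu, SimpleGraph.Reachable.refl _⟩).2

/-- A nonempty vertex set inducing a connected subgraph is spanned by a tree of `G`. -/
theorem exists_connected_subgraph_encard {V : Type*} [Finite V] {G : SimpleGraph V} {W : Set V}
    (hne : W.Nonempty) (h : (G.induce W).Preconnected) :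
    ∃ H : G.Subgraph, H.Connected ∧ H.verts = W ∧ H.edgeSet.encard + 1 = W.encard := by
  classical
  have := Fintype.ofFinite V
  have : Nonempty W := hne.to_subtype
  obtain ⟨T, hT, hTree⟩ := (SimpleGraph.Connected.mk h).exists_isTree_le
  let H : G.Subgraph :=
    { verts := W
      Adj := fun u v => ∃ (hu : u ∈ W) (hv : v ∈ W), T.Adj ⟨u, hu⟩ ⟨v, hv⟩
      adj_sub := fun ⟨_, _, h⟩ => hT h
      edge_vert := fun ⟨h, _, _⟩ => h
      symm := ⟨fun _ _ ⟨hu, hv, h⟩ => ⟨hv, hu, h.symm⟩⟩ }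
  have hcoe : H.coe = T := by
    ext ⟨a, ha⟩ ⟨b, hb⟩
    exact ⟨fun ⟨_, _, h⟩ => h, fun h => ⟨ha, hb, h⟩⟩
  refine ⟨H, ⟨hcoe ▸ hTree.connected⟩, rfl, ?_⟩
  rw [← SimpleGraph.Subgraph.image_coe_edgeSet_coe,
    (Sym2.map.injective Subtype.val_injective).encard_image]
  have h1 : H.coe.edgeSet.encard = T.edgeSet.encard := by rw [hcoe]
  rw [h1, ← SimpleGraph.coe_edgeFinset, Set.encard_coe_eq_coe_finsetCard,
    ← Set.coe_fintypeCard W, ← hTree.card_edgeFinset]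
  push_cast
  rfl

theorem steinerDist_le {V : Type*} [Fintype V] {G : SimpleGraph V} (hG : G.Connected)
    (S : Finset V) : steinerDist G S ≤ ((Fintype.card V - 1 : ℕ) : ℕ∞) := by
  have hne := hG.nonempty
  have hpre : (G.induce Set.univ).Preconnected :=
    SimpleGraph.preconnected_induce_of_prop fun c hc u _ v _ => by
      obtain ⟨w⟩ := hG.preconnected u v
      induction w with
      | nil => exact Iff.rfl
      | cons hadj _ ih => exact (hc _ trivial _ trivial hadj).trans (ih trivial trivial)
  obtain ⟨H, hH, hv, hE⟩ := exists_connected_subgraph_encard Set.univ_nonempty hpre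
  refine (iInf_le_of_le H <| iInf_le_of_le hH <| iInf_le_of_le (by simp [hv]) le_rfl).trans ?_
  rw [Set.encard_univ, ENat.card_eq_coe_fintype_card] at hE
  have hfin : H.edgeSet.encard ≠ ⊤ := by
    intro h
    rw [h] at hE
    exact absurd hE (by simp)
  lift H.edgeSet.encard to ℕ using hfin with m
  norm_cast at hE ⊢
  omega

/-- The Steiner distance of `S` has its largest possible value exactly when no proper vertex subset
containing `S` induces a connected subgraph. -/
theorem steinerDist_eq_iff {V : Type*} [Fintype V] {G : SimpleGraph V} (hG : G.Connected)
    {S : Finset V} (hS : S.Nonempty) :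
    steinerDist G S = ((Fintype.card V - 1 : ℕ) : ℕ∞) ↔
      ∀ W : Set V, (S : Set V) ⊆ W → (G.induce W).Preconnected → W = Set.univ := by
  classical
  constructor
  · intro h W hSW hW
    obtain ⟨H, hH, hv, hE⟩ :=
      exists_connected_subgraph_encard (hS.to_set.mono hSW) hW
    have hle : steinerDist G S ≤ H.edgeSet.encard :=
      iInf_le_of_le H <| iInf_le_of_le hH <| iInf_le_of_le (by rw [hv]; exact hSW) le_rfl
    rw [h] at hle
    have hpos : 0 < Fintype.card V := Fintype.card_pos_iff.2 hG.nonempty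
    apply Set.Finite.eq_of_subset_of_encard_le (Set.toFinite W) (Set.subset_univ W)
    rw [← hE, Set.encard_univ, ENat.card_eq_coe_fintype_card]
    calc (Fintype.card V : ℕ∞) = ((Fintype.card V - 1 : ℕ) : ℕ∞) + 1 := by
          norm_cast; omega
      _ ≤ _ := by gcongr
  · intro h
    refine le_antisymm (steinerDist_le hG S) ?_
    refine le_iInf fun H => le_iInf fun hH => le_iInf fun hSH => ?_
    have hv : H.verts = Set.univ := by
      refine h _ hSH ?_
      have := hH.induce_verts
      exact this.preconnected
    have hc := hH.coe.card_vert_le_card_edgeSet_add_one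
    have h1 : Nat.card H.verts = Fintype.card V := by
      rw [hv, Nat.card_univ, Nat.card_eq_fintype_card]
    rw [← SimpleGraph.Subgraph.image_coe_edgeSet_coe,
      (Sym2.map.injective Subtype.val_injective).encard_image,
      ← Set.Finite.cast_ncard_eq (Set.toFinite _)]
    rw [h1, Nat.card_coe_set_eq] at hc
    norm_cast
    omega

theorem sdiam_eq_iff {V : Type*} [Fintype V] {G : SimpleGraph V} (hG : G.Connected) {k : ℕ}
    (hk : 0 < k) (hn : 2 ≤ Fintype.card V) :
    sdiam G k = ((Fintype.card V - 1 : ℕ) : ℕ∞) ↔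
      ∃ S : Finset V, S.card = k ∧
        ∀ W : Set V, (S : Set V) ⊆ W → (G.induce W).Preconnected → W = Set.univ := by
  have hle : sdiam G k ≤ ((Fintype.card V - 1 : ℕ) : ℕ∞) :=
    iSup_le fun v => iSup_le fun S => iSup_le fun _ => iSup_le fun _ => steinerDist_le hG S
  constructor
  · intro h
    by_contra! hcon
    have hlt : sdiam G k ≤ ((Fintype.card V - 2 : ℕ) : ℕ∞) := by
      refine iSup_le fun v => iSup_le fun S => iSup_le fun hS => iSup_le fun hv => ?_
      have hne : steinerDist G S ≠ ((Fintype.card V - 1 : ℕ) : ℕ∞) := by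
        rw [Ne, steinerDist_eq_iff hG ⟨v, hv⟩]
        push Not
        exact hcon S hS
      have hlt := lt_of_le_of_ne (steinerDist_le hG S) hne
      lift steinerDist G S to ℕ using hlt.ne_top with m
      norm_cast at hlt ⊢
      omega
    rw [h] at hlt
    norm_cast at hlt
    omega
  · rintro ⟨S, hS, h⟩
    have hne : S.Nonempty := Finset.card_pos.1 (by omega)
    obtain ⟨v, hv⟩ := hne
    refine le_antisymm hle ?_
    rw [← (steinerDist_eq_iff hG ⟨v, hv⟩).2 h]
    exact le_iSup_of_le v <| le_iSup_of_le S <| le_iSup_of_le hS <| le_iSup_of_le hv le_rfl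

/-! ### Graphs described by a labelling -/

/-- `G` has order `n` and is described by `D`: its vertices can be labelled bijectively with
`0, …, n - 1` so that vertices with labels `i < j` are adjacent exactly when `D i j`. -/
def HasModel {V : Type*} (G : SimpleGraph V) (n : ℕ) (D : ℕ → ℕ → Prop) : Prop :=
  ∃ f : V → ℕ, Function.Injective f ∧ (∀ v, f v < n) ∧ (∀ k < n, ∃ v, f v = k) ∧
    ∀ u v, f u < f v → (G.Adj u v ↔ D (f u) (f v))

theorem HasModel.nonempty_iso {V W : Type*} {G : SimpleGraph V} {G' : SimpleGraph W} {n : ℕ}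
    {D : ℕ → ℕ → Prop} (h : HasModel G n D) (h' : HasModel G' n D) : Nonempty (G ≃g G') := by
  obtain ⟨f, f_inj, f_lt, f_surj, f_adj⟩ := h
  obtain ⟨g, g_inj, g_lt, g_surj, g_adj⟩ := h'
  choose a ha using fun v => g_surj (f v) (f_lt v)
  choose b hb using fun w => f_surj (g w) (g_lt w)
  refine ⟨⟨⟨a, b, fun v => f_inj (by rw [hb, ha]), fun w => g_inj (by rw [ha, hb])⟩, ?_⟩⟩
  intro u v
  change G'.Adj (a u) (a v) ↔ G.Adj u v
  rcases lt_trichotomy (f u) (f v) with h | h | h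
  · rw [f_adj u v h, g_adj _ _ (by rwa [ha, ha]), ha, ha]
  · obtain rfl := f_inj h
    simp
  · rw [G'.adj_comm, G.adj_comm, f_adj v u h, g_adj _ _ (by rwa [ha, ha]), ha, ha]

theorem HasModel.of_iso {V W : Type*} {G : SimpleGraph V} {G' : SimpleGraph W} {n : ℕ}
    {D : ℕ → ℕ → Prop} (e : G ≃g G') (h : HasModel G' n D) : HasModel G n D := by
  obtain ⟨f, f_inj, f_lt, f_surj, f_adj⟩ := h
  refine ⟨f ∘ e, f_inj.comp e.injective, fun v => f_lt _, fun k hk => ?_, fun u v huv => ?_⟩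
  · obtain ⟨w, hw⟩ := f_surj k hk
    exact ⟨e.symm w, by simp [hw]⟩
  · rw [← e.map_adj_iff]
    exact f_adj _ _ huv

/-- Changing the labels by a permutation `σ` of `{0, …, n - 1}`. -/
theorem HasModel.relabel {V : Type*} {G : SimpleGraph V} {n : ℕ} {D D' : ℕ → ℕ → Prop}
    (h : HasModel G n D) (σ : ℕ → ℕ) (σ_lt : ∀ k < n, σ k < n)
    (σ_inj : ∀ i < n, ∀ j < n, σ i = σ j → i = j)
    (hD : ∀ i j, i < j → j < n → (σ i < σ j → (D i j ↔ D' (σ i) (σ j))) ∧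
      (σ j < σ i → (D i j ↔ D' (σ j) (σ i)))) : HasModel G n D' := by
  obtain ⟨f, f_inj, f_lt, f_surj, f_adj⟩ := h
  have σ_surj : ∀ k < n, ∃ i < n, σ i = k := by
    intro k hk
    have := Finset.surj_on_of_inj_on_of_card_le (s := Finset.range n) (t := Finset.range n)
      (fun i _ => σ i) (fun i hi => by simpa using σ_lt i (by simpa using hi))
      (fun i j hi hj hij => σ_inj i (by simpa using hi) j (by simpa using hj) hij) le_rfl k
      (by simpa using hk)
    obtain ⟨i, hi, rfl⟩ := this
    exact ⟨i, by simpa using hi, rfl⟩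
  refine ⟨σ ∘ f, fun u v huv => f_inj (σ_inj _ (f_lt u) _ (f_lt v) huv), fun v => σ_lt _ (f_lt v),
    fun k hk => ?_, fun u v huv => ?_⟩
  · obtain ⟨i, hi, rfl⟩ := σ_surj k hk
    obtain ⟨v, rfl⟩ := f_surj i hi
    exact ⟨v, rfl⟩
  · rcases lt_trichotomy (f u) (f v) with h | h | h
    · rw [f_adj u v h]
      exact (hD _ _ h (f_lt v)).1 huv
    · simp [h] at huv
    · rw [G.adj_comm, f_adj v u h]
      exact (hD _ _ h (f_lt u)).2 huv

theorem HasModel.congr {V : Type*} {G : SimpleGraph V} {n : ℕ} {D D' : ℕ → ℕ → Prop}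
    (h : HasModel G n D) (hD : ∀ i j, i < j → j < n → (D i j ↔ D' i j)) : HasModel G n D' :=
  h.relabel id (fun _ h => h) (fun _ _ _ _ h => h)
    fun i j hij hj => ⟨fun _ => hD i j hij hj, fun h => absurd h (by simp; omega)⟩

/-- A labelling into `{0, …, n - 1}` of a graph of order `n` only has to be injective. -/
theorem HasModel.of_injective {V : Type*} [Fintype V] {G : SimpleGraph V} {n : ℕ}
    {D : ℕ → ℕ → Prop} (hn : Fintype.card V = n) (f : V → ℕ) (f_inj : Function.Injective f)
    (f_lt : ∀ v, f v < n) (f_adj : ∀ u v, f u < f v → (G.Adj u v ↔ D (f u) (f v))) :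
    HasModel G n D := by
  refine ⟨f, f_inj, f_lt, fun k hk => ?_, f_adj⟩
  have hb : Function.Bijective (fun v => (⟨f v, f_lt v⟩ : Fin n)) :=
    (Fintype.bijective_iff_injective_and_card _).2
      ⟨fun u v h => f_inj (by simpa using h), by simp [hn]⟩
  obtain ⟨v, hv⟩ := hb.2 ⟨k, hk⟩
  exact ⟨v, by simpa using hv⟩

/-- The relation for three consecutive intervals of labels, `[0, p)`, `[p, p + b)` and
`[p + b, ∞)`, each of them spanning a path, where the first vertex of the second interval is joined
to the vertices of the first one satisfying `N₁`, and the first vertex of the third interval to the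
earlier vertices satisfying `N₂`. -/
def threePaths (p b : ℕ) (N₁ N₂ : ℕ → Prop) (i j : ℕ) : Prop :=
  if j = p ∧ 0 < b then N₁ i else if j = p + b then N₂ i else i + 1 = j

/-- The relation for four consecutive paths with `a + 1`, `b + 1`, `c + 1` and `d + 1` vertices,
whose first vertices span the graph `H`. -/
def fourPathsModel (H : SimpleGraph (Fin 4)) (a b c : ℕ) (i j : ℕ) : Prop :=
  if j = a + 1 then i = 0 ∧ H.Adj 0 1
  else if j = a + b + 2 then i = 0 ∧ H.Adj 0 2 ∨ i = a + 1 ∧ H.Adj 1 2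
  else if j = a + b + c + 3 then
    i = 0 ∧ H.Adj 0 3 ∨ i = a + 1 ∧ H.Adj 1 3 ∨ i = a + b + 2 ∧ H.Adj 2 3
  else i + 1 = j

theorem fourPaths_hasModel (H : SimpleGraph (Fin 4)) (a b c d : ℕ) :
    HasModel (fourPaths H a b c d) (a + b + c + d + 4) (fourPathsModel H a b c) := by
  have hcard : Fintype.card (Fin 4 ⊕ (Σ i : Fin 4, Fin (![a, b, c, d] i))) =
      a + b + c + d + 4 := by
    simp [Fin.sum_univ_four]; omega
  let o : Fin 4 → ℕ := ![0, a + 1, a + b + 2, a + b + c + 3]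
  refine HasModel.of_injective hcard
    (Sum.elim o fun x => o x.1 + x.2.val + 1) ?_ ?_ ?_
  · rintro (x | ⟨x, k, hk⟩) (y | ⟨y, l, hl⟩) h <;> fin_cases x <;> fin_cases y <;>
      (try simp at hk) <;> (try simp at hl) <;> simp [o] at h ⊢ <;> first | omega | (subst h; rfl)
  · rintro (x | ⟨x, k, hk⟩) <;> fin_cases x <;> (try simp at hk) <;> simp [o] <;> omega
  · rintro (x | ⟨x, k, hk⟩) (y | ⟨y, l, hl⟩) h <;> fin_cases x <;> fin_cases y <;>
      (try simp at hk) <;> (try simp at hl) <;>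
      simp [o, fourPaths, attachPaths, fourPathsModel] at h ⊢ <;> grind

/-- The labelling of a path with two further paths: the path comes first, and the two others
follow. -/
theorem hasModel_of_two_paths {n p b c : ℕ} (hn : p + b + c = n)
    (G : SimpleGraph (Fin p ⊕ (Σ i : Fin 2, Fin (![b, c] i)))) (D : ℕ → ℕ → Prop)
    (h₁ : ∀ i j (hi : i < p) (hj : j < p), i < j →
      (G.Adj (.inl ⟨i, hi⟩) (.inl ⟨j, hj⟩) ↔ D i j))
    (h₂ : ∀ i j (hi : i < p) (hj : j < b),
      (G.Adj (.inl ⟨i, hi⟩) (.inr ⟨0, ⟨j, hj⟩⟩) ↔ D i (p + j)))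
    (h₃ : ∀ i j (hi : i < p) (hj : j < c),
      (G.Adj (.inl ⟨i, hi⟩) (.inr ⟨1, ⟨j, hj⟩⟩) ↔ D i (p + b + j)))
    (h₄ : ∀ i j (hi : i < b) (hj : j < b), i < j →
      (G.Adj (.inr ⟨0, ⟨i, hi⟩⟩) (.inr ⟨0, ⟨j, hj⟩⟩) ↔ D (p + i) (p + j)))
    (h₅ : ∀ i j (hi : i < b) (hj : j < c),
      (G.Adj (.inr ⟨0, ⟨i, hi⟩⟩) (.inr ⟨1, ⟨j, hj⟩⟩) ↔ D (p + i) (p + b + j)))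
    (h₆ : ∀ i j (hi : i < c) (hj : j < c), i < j →
      (G.Adj (.inr ⟨1, ⟨i, hi⟩⟩) (.inr ⟨1, ⟨j, hj⟩⟩) ↔ D (p + b + i) (p + b + j))) :
    HasModel G n D := by
  have hcard : Fintype.card (Fin p ⊕ (Σ i : Fin 2, Fin (![b, c] i))) = n := by
    simp [← hn, add_assoc]
  refine HasModel.of_injective hcard (Sum.elim Fin.val
    fun x => (![p, p + b] : Fin 2 → ℕ) x.1 + x.2.val) ?_ ?_ ?_
  · rintro (⟨x, hx⟩ | ⟨x, k, hk⟩) (⟨y, hy⟩ | ⟨y, l, hl⟩) h <;> (try fin_cases x) <;>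
      (try fin_cases y) <;> (try simp at hk) <;> (try simp at hl) <;> simp at h ⊢ <;>
      first | omega | (subst h; rfl)
  · rintro (⟨x, hx⟩ | ⟨x, k, hk⟩) <;> (try fin_cases x) <;> (try simp at hk) <;> simp <;> omega
  · rintro (⟨x, hx⟩ | ⟨x, k, hk⟩) (⟨y, hy⟩ | ⟨y, l, hl⟩) h
    · exact h₁ x y hx hy h
    · fin_cases y
      · exact h₂ x l hx hl
      · exact h₃ x l hx hl
    · fin_cases x <;> simp at h <;> omega
    · fin_cases x <;> fin_cases y
      · exact h₄ k l hk hl (by simpa using h)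
      · exact h₅ k l hk hl
      · have hl' : l < b := hl
        simp at h; omega
      · exact h₆ k l hk hl (by simpa using h)

theorem sigma_fin_eq_iff {ι : Type*} {ℓ : ι → ℕ} {s t : Σ i, Fin (ℓ i)} :
    s = t ↔ s.1 = t.1 ∧ s.2.val = t.2.val := by
  obtain ⟨i, x⟩ := s
  obtain ⟨j, y⟩ := t
  constructor
  · rintro ⟨⟩
    exact ⟨rfl, rfl⟩
  · rintro ⟨h, h'⟩
    obtain rfl : i = j := h
    obtain rfl := Fin.ext h'
    rfl

theorem treeGraph_hasModel (n a b c d : ℕ) (h : a + b + c + d + 1 ≤ n) :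
    HasModel (treeGraph n a b c d h) n
      (threePaths (n - b - c) b (fun k => k = a) (fun k => k = n - b - c - d - 1)) := by
  have hn : n - b - c + b + c = n := by omega
  apply hasModel_of_two_paths hn <;> intros <;>
    simp [treeGraph, attachPaths, threePaths, SimpleGraph.pathGraph_adj] <;>
    (try split_ifs) <;> omega

theorem triangleGraph_hasModel (n a b c d : ℕ) (h : a + b + c + d + 3 ≤ n) :
    HasModel (triangleGraph n a b c d h) n
      (threePaths (n - b - c - 1) (b + 1) (fun k => a ≤ k ∧ k ≤ a + 1)
        (fun k => k = n - b - c - d - 2)) := by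
  have hn : n - b - c - 1 + (b + 1) + c = n := by omega
  apply hasModel_of_two_paths hn <;> intros <;>
    simp [triangleGraph, attachPaths, threePaths, SimpleGraph.pathGraph_adj,
        SimpleGraph.edge_adj, sigma_fin_eq_iff] <;>
    (try split_ifs) <;> omega

theorem triangleGraph'_hasModel (n a b c d : ℕ) (h : a + b + c + d + 5 ≤ n) :
    HasModel (triangleGraph' n a b c d h) n
      (threePaths (n - b - c - 2) (b + 1) (fun k => a ≤ k ∧ k ≤ a + 1)
        (fun k => n - b - c - d - 4 ≤ k ∧ k ≤ n - b - c - d - 3)) := by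
  have hn : n - b - c - 2 + (b + 1) + (c + 1) = n := by omega
  apply hasModel_of_two_paths hn <;> intros <;>
    simp [triangleGraph', attachPaths, threePaths, SimpleGraph.pathGraph_adj,
        SimpleGraph.edge_adj, sigma_fin_eq_iff] <;>
    (try split_ifs) <;> omega

/-! ### Symmetries of the relation for three paths -/

/-- Reversing the first path. -/
theorem HasModel.reverse {V : Type*} {G : SimpleGraph V} {n p b : ℕ} {N₁ N₂ : ℕ → Prop}
    (h : HasModel G n (threePaths p b N₁ N₂)) (hp : p + b ≤ n) :
    HasModel G n (threePaths p b (fun k => k < p ∧ N₁ (p - 1 - k))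
      (fun k => if k < p then N₂ (p - 1 - k) else N₂ k)) := by
  refine h.relabel (fun k => if k < p then p - 1 - k else k) ?_ ?_ ?_
  · intro k hk
    split_ifs <;> omega
  · intro i hi j hj hij
    split_ifs at hij <;> omega
  · intro i j hij hj
    have hi : i < p → p - 1 - (p - 1 - i) = i := by omega
    dsimp only [threePaths]
    rcases lt_or_ge j p with h1 | h1
    · have hi' : i < p := by omega
      simp only [h1, hi', if_true]
      constructor <;> intro <;> split_ifs <;> omega
    · simp only [h1.not_gt, if_false]
      refine ⟨fun h2 => ?_, fun h2 => ?_⟩ <;> split_ifs at h2 ⊢ with h3 h4 h5 <;>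
        first | rfl | omega | (rw [hi (by omega)]; exact (and_iff_right (by omega)).symm) |
          rw [hi (by omega)]

/-- Exchanging the part of the first path beyond the vertex `i` with the second path. -/
theorem HasModel.swap_legs {V : Type*} {G : SimpleGraph V} {n p b i e : ℕ} {N₂ : ℕ → Prop}
    (h : HasModel G n (threePaths p b (fun k => i ≤ k ∧ k ≤ i + e) N₂)) (hp : p + b ≤ n)
    (he : e ≤ 1) (hi : i + e < p) (hb : 0 < b) :
    HasModel G n (threePaths (i + 1 + b) (p - 1 - i) (fun k => i ≤ k ∧ k ≤ i + e)
      (fun k => N₂ (if k ≤ i then k else if k < i + 1 + b then k - (i + 1) + p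
        else if k < p + b then k - b else k))) := by
  refine h.relabel (fun k => if k ≤ i then k else if k < p then k + b
      else if k < p + b then k - p + (i + 1) else k) ?_ ?_ ?_
  · intro k hk
    split_ifs <;> omega
  · intro j hj k hk hjk
    split_ifs at hjk <;> omega
  · intro k j hkj hj
    dsimp only [threePaths]
    by_cases h1 : j = p + b
    · subst h1
      have e1 : ¬ (p + b ≤ i) := by omega
      have e2 : ¬ (p + b < p) := by omega
      have e3 : ¬ (p + b = p ∧ 0 < b) := by omega
      have e4 : ¬ (p + b = i + 1 + b ∧ 0 < p - 1 - i) := by omega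
      have e5 : p + b = i + 1 + b + (p - 1 - i) := by omega
      simp only [e1, e2, e3, e4, if_false, lt_irrefl, if_true, ← e5]
      refine ⟨fun _ => ?_, fun h2 => ?_⟩
      · refine iff_of_eq (congrArg N₂ ?_)
        split_ifs <;> omega
      · split_ifs at h2 <;> omega
    · have h2 : ∀ x, x < i + 1 + b + (p - 1 - i) → (x ≠ i + 1 + b + (p - 1 - i)) := by omega
      simp only [h1, if_false]
      refine ⟨fun h3 => ?_, fun h3 => ?_⟩
      · rw [if_neg (c := _ = i + 1 + b + (p - 1 - i))]
        · split_ifs at h3 ⊢ <;> omega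
        · split_ifs at h3 ⊢ <;> omega
      · rw [if_neg (c := _ = i + 1 + b + (p - 1 - i))]
        · split_ifs at h3 ⊢ <;> omega
        · split_ifs at h3 ⊢ <;> omega

/-- Exchanging the second and the third path when both are joined to the first one only. -/
theorem HasModel.swap_paths {V : Type*} {G : SimpleGraph V} {n p b : ℕ} {N₁ N₂ : ℕ → Prop}
    (h : HasModel G n (threePaths p b N₁ N₂)) (hp : p + b ≤ n)
    (h₁ : ∀ k, N₁ k → k < p) (h₂ : ∀ k, N₂ k → k < p) :
    HasModel G n (threePaths p (n - p - b) N₂ N₁) := by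
  refine h.relabel (fun k => if k < p then k else if k < p + b then k + (n - p - b)
      else k - b) ?_ ?_ ?_
  · intro k hk
    split_ifs <;> omega
  · intro j hj k hk hjk
    split_ifs at hjk <;> omega
  · intro k j hkj hj
    have h₁' : ∀ m, p ≤ m → (N₁ m ↔ False) := fun m hm => iff_false_intro fun h => by
      have := h₁ m h; omega
    have h₂' : ∀ m, p ≤ m → (N₂ m ↔ False) := fun m hm => iff_false_intro fun h => by
      have := h₂ m h; omega
    dsimp only [threePaths]
    refine ⟨fun h3 => ?_, fun h3 => ?_⟩
    · split_ifs at h3 ⊢ <;>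
        first | rfl | omega
    · have h4 : p ≤ k ∧ k < p + b ∧ p + b ≤ j := by
        split_ifs at h3 <;> omega
      obtain ⟨h4, h5, h6⟩ := h4
      have h7 : ¬ j < p := by omega
      have h8 := h₁' (j - b) (by omega)
      have h9 := h₂' (j - b) (by omega)
      simp only [h4.not_gt, h5, h6.not_gt, h7, if_true, if_false, h₁' k h4, h₂' k h4] at h3 ⊢
      simp only [h8, h9]
      split_ifs <;> first | rfl | omega | (rw [false_iff]; omega) | (rw [iff_false]; omega)

/-! ### Recognizing the graphs of the list -/

/-- `G` is one of the graphs `T`, `△`, `△'`, `G₁`, `G₂`, `G₃` of order `n`. -/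
def IsListed {V : Type*} (G : SimpleGraph V) (n : ℕ) : Prop :=
  (∃ (a b c d : ℕ) (h : a + b + c + d + 1 ≤ n), Nonempty (G ≃g treeGraph n a b c d h)) ∨
  (∃ (a b c d : ℕ) (h : a + b + c + d + 3 ≤ n), Nonempty (G ≃g triangleGraph n a b c d h)) ∨
  (∃ (a b c d : ℕ) (h : a + b + c + d + 5 ≤ n), Nonempty (G ≃g triangleGraph' n a b c d h)) ∨
  (∃ a b c d : ℕ, a + b + c + d + 4 = n ∧
    Nonempty (G ≃g fourPaths (⊤ : SimpleGraph (Fin 4)) a b c d)) ∨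
  (∃ a b c d : ℕ, a + b + c + d + 4 = n ∧
    Nonempty (G ≃g fourPaths (SimpleGraph.cycleGraph 4) a b c d)) ∨
  (∃ a b c d : ℕ, a + b + c + d + 4 = n ∧ Nonempty (G ≃g fourPaths K4minus a b c d))

theorem threePaths_congr {p b p' b' n : ℕ} {N₁ N₁' N₂ N₂' : ℕ → Prop} (hp : p = p') (hb : b = b')
    (h₁ : 0 < b → ∀ k < p, (N₁ k ↔ N₁' k)) (h₂ : p + b < n → ∀ k < p + b, (N₂ k ↔ N₂' k)) (i j : ℕ)
    (hij : i < j) (hj : j < n) : threePaths p b N₁ N₂ i j ↔ threePaths p' b' N₁' N₂' i j := by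
  subst hp hb
  unfold threePaths
  split_ifs with h3 h4
  · exact h₁ h3.2 i (by omega)
  · exact h₂ (by omega) i (by omega)
  · rfl

/-- Rewrites conditional propositions into a form accessible to `omega`. -/
theorem if_then_else_iff {P Q R : Prop} [Decidable P] :
    (if P then Q else R) ↔ (P ∧ Q ∨ ¬ P ∧ R) := by
  split_ifs <;> simp_all

section

variable {V : Type*} {G : SimpleGraph V} {n p b : ℕ}

theorem isListed_of_tree {i u : ℕ}
    (h : HasModel G n (threePaths p b (fun k => k = i) (fun k => k = u)))
    (hp : p + b ≤ n) (hiu : i ≤ u) (hu : u < p) : IsListed G n := by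
  refine Or.inl ⟨i, b, n - p - b, p - 1 - u, by omega, h.nonempty_iso ?_⟩
  refine (treeGraph_hasModel n _ _ _ _ _).congr (threePaths_congr ?_ ?_ ?_ ?_) <;> intros <;> omega

theorem isListed_of_triangle {i u : ℕ}
    (h : HasModel G n (threePaths p b (fun k => i ≤ k ∧ k ≤ i + 1) (fun k => k = u)))
    (hp : p + b ≤ n) (hb : 0 < b) (hiu : i + 1 ≤ u) (hu : u < p) : IsListed G n := by
  refine Or.inr <| Or.inl ⟨i, b - 1, n - p - b, p - 1 - u, by omega, h.nonempty_iso ?_⟩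
  refine (triangleGraph_hasModel n _ _ _ _ _).congr (threePaths_congr ?_ ?_ ?_ ?_) <;> intros <;>
    omega

theorem isListed_of_two_triangles {i u : ℕ}
    (h : HasModel G n (threePaths p b (fun k => i ≤ k ∧ k ≤ i + 1) (fun k => u ≤ k ∧ k ≤ u + 1)))
    (hp : p + b < n) (hb : 0 < b) (hiu : i + 1 ≤ u) (hu : u + 1 < p) : IsListed G n := by
  refine Or.inr <| Or.inr <| Or.inl
    ⟨i, b - 1, n - p - b - 1, p - 2 - u, by omega, h.nonempty_iso ?_⟩
  refine (triangleGraph'_hasModel n _ _ _ _ _).congr (threePaths_congr ?_ ?_ ?_ ?_) <;> intros <;>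
    omega

/-- Each of the two further paths is joined to one vertex of the first path (`e = 0`) or to two
consecutive ones (`e = 1`), the second path on the left of the third one. -/
theorem isListed_of_dumbbell {i u e₁ e₂ : ℕ} (he₁ : e₁ ≤ 1) (he₂ : e₂ ≤ 1)
    (h : HasModel G n (threePaths p b (fun k => i ≤ k ∧ k ≤ i + e₁) (fun k => u ≤ k ∧ k ≤ u + e₂)))
    (hp : p + b ≤ n) (hb : 0 < e₁ → 0 < b) (hc : 0 < e₂ → p + b < n) (hiu : i + e₁ ≤ u)
    (hu : u + e₂ < p) : IsListed G n := by
  obtain rfl | rfl : e₁ = 0 ∨ e₁ = 1 := by omega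
  · obtain rfl | rfl : e₂ = 0 ∨ e₂ = 1 := by omega
    · refine isListed_of_tree (h.congr (threePaths_congr rfl rfl ?_ ?_)) hp hiu hu <;> intros <;>
        omega
    · -- Reading the first path backwards exchanges the roles of the second and the third path, and
      -- the triangle comes first.
      have h' := (h.reverse hp).swap_paths hp (by intros; omega)
        (by intro k hk; split_ifs at hk <;> omega)
      refine isListed_of_triangle (i := p - 2 - u) (u := p - 1 - i)
        (h'.congr (threePaths_congr rfl rfl ?_ ?_)) ?_ ?_ ?_ ?_
      · intro _ k hk
        rw [if_pos hk]; omega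
      · intros; omega
      all_goals omega
  · obtain rfl | rfl : e₂ = 0 ∨ e₂ = 1 := by omega
    · refine isListed_of_triangle (h.congr (threePaths_congr rfl rfl ?_ ?_)) hp
        (by omega) hiu hu <;> intros <;> omega
    · exact isListed_of_two_triangles h (by omega) (by omega) hiu hu

/-- The four-cycle consists of `i - 1`, `i`, `i + 1` and the first vertex of the third path. -/
theorem isListed_of_four_cycle {i : ℕ}
    (h : HasModel G n (threePaths p b (fun k => k = i) (fun k => k + 1 = i ∨ k = i + 1)))
    (hp : p + b < n) (hi : 0 < i) (hip : i + 1 < p) : IsListed G n := by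
  refine Or.inr <| Or.inr <| Or.inr <| Or.inr <| Or.inl
    ⟨i - 1, b, p - 2 - i, n - p - b - 1, by omega, HasModel.nonempty_iso (n := n)
      (D := fourPathsModel (SimpleGraph.cycleGraph 4) (i - 1) b (p - 2 - i)) ?_ ?_⟩
  · have h01 : (SimpleGraph.cycleGraph 4).Adj 0 1 := by decide
    have h02 : ¬ (SimpleGraph.cycleGraph 4).Adj 0 2 := by decide
    have h03 : (SimpleGraph.cycleGraph 4).Adj 0 3 := by decide
    have h12 : (SimpleGraph.cycleGraph 4).Adj 1 2 := by decide
    have h13 : ¬ (SimpleGraph.cycleGraph 4).Adj 1 3 := by decide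
    have h23 : (SimpleGraph.cycleGraph 4).Adj 2 3 := by decide
    refine h.relabel (fun k => if k < i then i - 1 - k else if k = i then i else if k < p then k + b
      else if k < p + b then k - p + (i + 1) else k) ?_ ?_ ?_
    · intro k hk
      split_ifs <;> omega
    · intro j hj k hk hjk
      split_ifs at hjk <;> omega
    · intro k j hkj hj
      have hk : k < n := hkj.trans hj
      have key : ∀ m, m < n → ∃ x, (if m < i then i - 1 - m else if m = i then i
          else if m < p then m + b else if m < p + b then m - p + (i + 1) else m) = x ∧
          (m < i ∧ x + m + 1 = i ∨ m = i ∧ x = m ∨ i < m ∧ m < p ∧ x = m + b ∨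
            p ≤ m ∧ m < p + b ∧ x + p = m + i + 1 ∨ p + b ≤ m ∧ x = m) := by
        intro m hm
        refine ⟨_, rfl, ?_⟩
        split_ifs <;> omega
      obtain ⟨x, hx, hx'⟩ := key k hk
      obtain ⟨y, hy, hy'⟩ := key j hj
      rw [hx, hy]
      clear hx hy key h
      have e1 : i - 1 + 1 = i := by omega
      have e2 : i - 1 + b + 2 = i + b + 1 := by omega
      have e3 : i - 1 + b + (p - 2 - i) + 3 = p + b := by omega
      simp only [threePaths, fourPathsModel, h01, h02, h03, h12, h13, h23, and_true, and_false,
        false_or, e1, e2, e3, if_then_else_iff]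
      rcases hx' with hx' | hx' | hx' | hx' | hx' <;> rcases hy' with hy' | hy' | hy' | hy' | hy' <;>
        try (exfalso; omega)
      all_goals omega
  · convert fourPaths_hasModel (SimpleGraph.cycleGraph 4) (i - 1) b (p - 2 - i) (n - p - b - 1)
      using 1
    omega

/-- As in `isListed_of_four_cycle`, with a chord from `i` to the third path; the nonadjacent vertices
`0` and `1` of `K4minus` are `i - 1` and `i + 1`. -/
theorem isListed_of_four_cycle_chord {i : ℕ}
    (h : HasModel G n (threePaths p b (fun k => k = i) (fun k => i ≤ k + 1 ∧ k ≤ i + 1)))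
    (hp : p + b < n) (hi : 0 < i) (hip : i + 1 < p) : IsListed G n := by
  refine Or.inr <| Or.inr <| Or.inr <| Or.inr <| Or.inr
    ⟨i - 1, p - 2 - i, b, n - p - b - 1, by omega, HasModel.nonempty_iso (n := n)
      (D := fourPathsModel K4minus (i - 1) (p - 2 - i) b) ?_ ?_⟩
  · have h01 : ¬ K4minus.Adj 0 1 := by simp [K4minus]
    have h02 : K4minus.Adj 0 2 := by simp [K4minus]
    have h03 : K4minus.Adj 0 3 := by simp [K4minus]
    have h12 : K4minus.Adj 1 2 := by simp [K4minus]
    have h13 : K4minus.Adj 1 3 := by simp [K4minus]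
    have h23 : K4minus.Adj 2 3 := by simp [K4minus]
    refine h.relabel (fun k => if k < i then i - 1 - k else if k = i then p - 1
      else if k < p then k - 1 else k) ?_ ?_ ?_
    · intro k hk
      split_ifs <;> omega
    · intro j hj k hk hjk
      split_ifs at hjk <;> omega
    · intro k j hkj hj
      have hk : k < n := hkj.trans hj
      have key : ∀ m, m < n → ∃ x, (if m < i then i - 1 - m else if m = i then p - 1
          else if m < p then m - 1 else m) = x ∧
          (m < i ∧ x + m + 1 = i ∨ m = i ∧ x + 1 = p ∨ i < m ∧ m < p ∧ x + 1 = m ∨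
            p ≤ m ∧ x = m) := by
        intro m hm
        refine ⟨_, rfl, ?_⟩
        split_ifs <;> omega
      obtain ⟨x, hx, hx'⟩ := key k hk
      obtain ⟨y, hy, hy'⟩ := key j hj
      rw [hx, hy]
      clear hx hy key h
      have e1 : i - 1 + 1 = i := by omega
      have e2 : i - 1 + (p - 2 - i) + 2 = p - 1 := by omega
      have e3 : i - 1 + (p - 2 - i) + b + 3 = p + b := by omega
      simp only [threePaths, fourPathsModel, h01, h02, h03, h12, h13, h23, and_true, and_false,
        false_or, e1, e2, e3, if_then_else_iff]
      rcases hx' with hx' | hx' | hx' | hx' <;> rcases hy' with hy' | hy' | hy' | hy' <;>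
        first | (exfalso; omega) | omega
  · convert fourPaths_hasModel K4minus (i - 1) (p - 2 - i) b (n - p - b - 1) using 1
    omega

/-- The two triangles on the edge joining `i` and `i + 1` span `K4minus`, whose nonadjacent vertices
`0` and `1` are the first vertices of the second and of the third path. -/
theorem isListed_of_two_triangles_on_edge {i : ℕ}
    (h : HasModel G n (threePaths p b (fun k => i ≤ k ∧ k ≤ i + 1) (fun k => i ≤ k ∧ k ≤ i + 1)))
    (hp : p + b < n) (hb : 0 < b) (hip : i + 1 < p) : IsListed G n := by
  refine Or.inr <| Or.inr <| Or.inr <| Or.inr <| Or.inr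
    ⟨b - 1, n - p - b - 1, i, p - 2 - i, by omega, HasModel.nonempty_iso (n := n)
      (D := fourPathsModel K4minus (b - 1) (n - p - b - 1) i) ?_ ?_⟩
  · have h01 : ¬ K4minus.Adj 0 1 := by simp [K4minus]
    have h02 : K4minus.Adj 0 2 := by simp [K4minus]
    have h03 : K4minus.Adj 0 3 := by simp [K4minus]
    have h12 : K4minus.Adj 1 2 := by simp [K4minus]
    have h13 : K4minus.Adj 1 3 := by simp [K4minus]
    have h23 : K4minus.Adj 2 3 := by simp [K4minus]
    refine h.relabel (fun k => if k ≤ i then n - p + i - k else if k < p then k + n - p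
      else k - p) ?_ ?_ ?_
    · intro k hk
      split_ifs <;> omega
    · intro j hj k hk hjk
      split_ifs at hjk <;> omega
    · intro k j hkj hj
      have hk : k < n := hkj.trans hj
      have key : ∀ m, m < n → ∃ x, (if m ≤ i then n - p + i - m else if m < p then m + n - p
          else m - p) = x ∧
          (m ≤ i ∧ x + m + p = n + i ∨ i < m ∧ m < p ∧ x + p = m + n ∨ p ≤ m ∧ x + p = m) := by
        intro m hm
        refine ⟨_, rfl, ?_⟩
        split_ifs <;> omega
      obtain ⟨x, hx, hx'⟩ := key k hk
      obtain ⟨y, hy, hy'⟩ := key j hj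
      rw [hx, hy]
      clear hx hy key h
      have e1 : b - 1 + 1 = b := by omega
      have e2 : b - 1 + (n - p - b - 1) + 2 = n - p := by omega
      have e3 : b - 1 + (n - p - b - 1) + i + 3 = n - p + i + 1 := by omega
      simp only [threePaths, fourPathsModel, h01, h02, h03, h12, h13, h23, and_true, and_false,
        false_or, e1, e2, e3, if_then_else_iff]
      rcases hx' with hx' | hx' | hx' <;> rcases hy' with hy' | hy' | hy' <;>
        first | (exfalso; omega) | omega
  · convert fourPaths_hasModel K4minus (b - 1) (n - p - b - 1) i (p - 2 - i) using 1
    omega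

/-- The complete graph is spanned by `i`, `i + 1` and the first vertices of the other two paths. -/
theorem isListed_of_complete_four {i : ℕ}
    (h : HasModel G n (threePaths p b (fun k => i ≤ k ∧ k ≤ i + 1)
      (fun k => i ≤ k ∧ k ≤ i + 1 ∨ k = p)))
    (hp : p + b < n) (hb : 0 < b) (hip : i + 1 < p) : IsListed G n := by
  refine Or.inr <| Or.inr <| Or.inr <| Or.inl
    ⟨i, p - 2 - i, b - 1, n - p - b - 1, by omega, HasModel.nonempty_iso (n := n)
      (D := fourPathsModel ⊤ i (p - 2 - i) (b - 1)) ?_ ?_⟩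
  · refine h.relabel (fun k => if k ≤ i then i - k else k) ?_ ?_ ?_
    · intro k hk
      split_ifs <;> omega
    · intro j hj k hk hjk
      split_ifs at hjk <;> omega
    · intro k j hkj hj
      have hk : k < n := hkj.trans hj
      have key : ∀ m, m < n → ∃ x, (if m ≤ i then i - m else m) = x ∧
          (m ≤ i ∧ x + m = i ∨ i < m ∧ x = m) := by
        intro m hm
        refine ⟨_, rfl, ?_⟩
        split_ifs <;> omega
      obtain ⟨x, hx, hx'⟩ := key k hk
      obtain ⟨y, hy, hy'⟩ := key j hj
      rw [hx, hy]
      clear hx hy key h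
      have e2 : i + (p - 2 - i) + 2 = p := by omega
      have e3 : i + (p - 2 - i) + (b - 1) + 3 = p + b := by omega
      simp only [threePaths, fourPathsModel, SimpleGraph.top_adj, ne_eq, and_true, e2, e3,
        if_then_else_iff, Fin.reduceEq, not_false_eq_true]
      rcases hx' with hx' | hx' <;> rcases hy' with hy' | hy' <;>
        first | (exfalso; omega) | omega
  · convert fourPaths_hasModel ⊤ i (p - 2 - i) (b - 1) (n - p - b - 1) using 1
    omega

end

/-! ### Decomposing the graph into shortest paths -/

/-- A shortest path from a nonempty set `A` to the vertex `s`, as a sequence `q 0, …, q b`. -/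
theorem exists_shortest_path_from_set {V : Type*} {G : SimpleGraph V} (hG : G.Connected)
    {A : Set V} (hA : A.Nonempty) {s : V} (hs : s ∉ A) :
    ∃ (b : ℕ) (q : ℕ → V), 0 < b ∧ q 0 ∈ A ∧ q b = s ∧
      (∀ j ≤ b, ∀ x ∈ A, j ≤ G.dist (q j) x) ∧
      ∀ i j, i ≤ j → j ≤ b → G.dist (q i) (q j) = j - i := by
  classical
  obtain ⟨a, ha, hmin⟩ := (measure fun a => G.dist a s).wf.has_min A hA
  replace hmin : ∀ x ∈ A, G.dist a s ≤ G.dist x s := fun x hx => not_lt.1 (hmin x hx)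
  obtain ⟨w, hw⟩ := hG.exists_walk_length_eq_dist a s
  have hle : ∀ i j, i ≤ j → j ≤ w.length → G.dist (w.getVert i) (w.getVert j) ≤ j - i := by
    intro i j hij
    induction j, hij using Nat.le_induction with
    | base => simp
    | succ j hij ih =>
      intro hj
      have h1 := ih (by omega)
      have h2 : G.dist (w.getVert j) (w.getVert (j + 1)) = 1 :=
        SimpleGraph.dist_eq_one_iff_adj.2 (w.adj_getVert_succ (by omega))
      have h3 := hG.dist_triangle (u := w.getVert i) (v := w.getVert j) (w := w.getVert (j + 1))
      omega
  have h0 : w.getVert 0 = a := w.getVert_zero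
  have hend : w.getVert w.length = s := w.getVert_length
  have hpos : 0 < G.dist a s := hG.pos_dist_of_ne (by rintro rfl; exact hs ha)
  refine ⟨w.length, w.getVert, by omega, by rwa [h0], hend, fun j hj x hx => ?_,
    fun i j hij hj => ?_⟩
  · have h1 := hle j w.length hj le_rfl
    rw [hend] at h1
    have h2 := hmin x hx
    have h3 := hG.dist_triangle (u := x) (v := w.getVert j) (w := s)
    rw [G.dist_comm]
    omega
  · have h1 := hle i j hij hj
    have h2 := hle 0 i (by omega) (by omega)
    have h3 := hle j w.length hj le_rfl
    rw [h0] at h2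
    rw [hend] at h3
    have h4 := hG.dist_triangle (u := a) (v := w.getVert i) (w := s)
    have h5 := hG.dist_triangle (u := w.getVert i) (v := w.getVert j) (w := s)
    omega

/-- An injective sequence of `m` vertices is prolonged by a shortest path from the set of its terms
to a further vertex `s`. -/
theorem exists_extension_by_path {V : Type*} {G : SimpleGraph V} (hG : G.Connected) {g : ℕ → V}
    {m : ℕ} (hm : 0 < m) (hg : Set.InjOn g (Set.Iio m)) {s : V} (hs : s ∉ g '' Set.Iio m) :
    ∃ (b : ℕ) (g' : ℕ → V), 0 < b ∧ (∀ i < m, g' i = g i) ∧ Set.InjOn g' (Set.Iio (m + b)) ∧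
      g' (m + b - 1) = s ∧ (∃ i < m, G.Adj (g' i) (g' m)) ∧
      (∀ i j, i < j → m < j → j < m + b → (G.Adj (g' i) (g' j) ↔ i + 1 = j)) ∧
      (∀ i j, m ≤ i → i ≤ j → j < m + b → G.dist (g' i) (g' j) = j - i) ∧
      ∀ i < m, ∀ j, m ≤ j → j < m + b → j - m + 1 ≤ G.dist (g' i) (g' j) := by
  obtain ⟨b, q, hb, ⟨i₀, hi₀, hq0⟩, hqb, hA, hd⟩ :=
    exists_shortest_path_from_set hG (A := g '' Set.Iio m) ⟨g 0, 0, hm, rfl⟩ hs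
  replace hi₀ : i₀ < m := hi₀
  obtain ⟨g', e1, e2⟩ : ∃ g' : ℕ → V, (∀ k < m, g' k = g k) ∧ ∀ k, m ≤ k → g' k = q (k - m + 1) :=
    ⟨fun k => if k < m then g k else q (k - m + 1), fun k hk => if_pos hk,
      fun k hk => if_neg hk.not_gt⟩
  have k1 : ∀ i j, m ≤ i → i ≤ j → j < m + b → G.dist (g' i) (g' j) = j - i := by
    intro i j hi hij hj
    rw [e2 i hi, e2 j (by omega), hd _ _ (by omega) (by omega)]
    omega
  have k2 : ∀ i < m, ∀ j, m ≤ j → j < m + b → j - m + 1 ≤ G.dist (g' i) (g' j) := by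
    intro i hi j hj hjb
    rw [e1 i hi, e2 j hj, G.dist_comm]
    exact hA _ (by omega) _ ⟨i, hi, rfl⟩
  refine ⟨b, g', hb, e1, ?_, ?_, ⟨i₀, hi₀, ?_⟩, ?_, k1, k2⟩
  · have aux : ∀ i j, i < j → j < m + b → g' i ≠ g' j := by
      intro i j hij hj h
      rcases lt_or_ge j m with h1 | h1
      · rw [e1 i (by omega), e1 j h1] at h
        exact hij.ne (hg (show i ∈ Set.Iio m from hij.trans h1) h1 h)
      · rcases lt_or_ge i m with h2 | h2
        · have := k2 i h2 j h1 hj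
          rw [h, SimpleGraph.dist_self] at this
          omega
        · have := k1 i j h2 hij.le hj
          rw [h, SimpleGraph.dist_self] at this
          omega
    intro i hi j hj hij
    rcases lt_trichotomy i j with h | h | h
    · exact absurd hij (aux i j h hj)
    · exact h
    · exact absurd hij.symm (aux j i h hi)
  · rw [e2 _ (by omega), ← hqb]
    congr 1
    omega
  · rw [e1 _ hi₀, e2 m le_rfl, hq0, ← SimpleGraph.dist_eq_one_iff_adj,
      hd 0 _ (by omega) (by omega)]
    omega
  · intro i j hij hmj hj
    rw [← SimpleGraph.dist_eq_one_iff_adj]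
    rcases lt_or_ge i m with h2 | h2
    · have := k2 i h2 j hmj.le hj
      omega
    · have := k1 i j h2 hij.le hj
      omega

/-- The terms of a sequence span a connected graph when each of them but the first is adjacent to an
earlier one. -/
theorem preconnected_induce_image {V : Type*} {G : SimpleGraph V} {g : ℕ → V} {m : ℕ}
    (h : ∀ j, 0 < j → j < m → ∃ i < j, G.Adj (g i) (g j)) :
    (G.induce (g '' Set.Iio m)).Preconnected := by
  refine SimpleGraph.preconnected_induce_of_prop fun c hc => ?_
  have key : ∀ j, j < m → (c (g j) ↔ c (g 0)) := by
    intro j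
    induction j using Nat.strong_induction_on with
    | _ j ih =>
      intro hj
      rcases Nat.eq_zero_or_pos j with rfl | hpos
      · rfl
      · obtain ⟨i, hi, hadj⟩ := h j hpos hj
        rw [← ih i hi (hi.trans hj)]
        exact (hc _ ⟨i, hi.trans hj, rfl⟩ _ ⟨j, hj, rfl⟩ hadj).symm
  rintro _ ⟨i, hi, rfl⟩ _ ⟨j, hj, rfl⟩
  rw [key i hi, key j hj]

theorem hasModel_of_enumeration {V : Type*} {G : SimpleGraph V} {g : ℕ → V} {n : ℕ}
    {D : ℕ → ℕ → Prop} (hg : Set.InjOn g (Set.Iio n)) (hsurj : g '' Set.Iio n = Set.univ)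
    (hD : ∀ i j, i < j → j < n → (G.Adj (g i) (g j) ↔ D i j)) : HasModel G n D := by
  have h : ∀ v, ∃ i, i < n ∧ g i = v := fun v => by
    have : v ∈ g '' Set.Iio n := hsurj ▸ trivial
    exact this
  choose f hf hgf using h
  refine ⟨f, fun u v huv => by rw [← hgf u, ← hgf v, huv], hf,
    fun k hk => ⟨g k, hg (hf _) hk (hgf _)⟩, fun u v huv => ?_⟩
  rw [← hD _ _ huv (hf v), hgf, hgf]

theorem card_eq_of_enumeration {V : Type*} [Fintype V] {g : ℕ → V} {n : ℕ}
    (hg : Set.InjOn g (Set.Iio n)) (hsurj : g '' Set.Iio n = Set.univ) : Fintype.card V = n := by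
  rw [← Nat.card_eq_fintype_card, ← Set.ncard_univ, ← hsurj, hg.ncard_image,
    Set.ncard_eq_toFinset_card']
  simp

/-- In the graph on `{0, …, n - 1}` described by `D`, the vertex `x` is a cut vertex: some property
is invariant along the edges that avoid `x` but not constant on the remaining vertices. -/
def IsCutLabel (n : ℕ) (D : ℕ → ℕ → Prop) (x : ℕ) : Prop :=
  ∃ c : ℕ → Prop, (∀ i j, i < j → j < n → i ≠ x → j ≠ x → D i j → (c i ↔ c j)) ∧
    ∃ i < n, ∃ j < n, i ≠ x ∧ j ≠ x ∧ c i ∧ ¬ c j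

theorem isCutLabel_of_enumeration {V : Type*} {G : SimpleGraph V} {g : ℕ → V} {n : ℕ}
    {D : ℕ → ℕ → Prop} (hg : Set.InjOn g (Set.Iio n)) (hsurj : g '' Set.Iio n = Set.univ)
    (hD : ∀ i j, i < j → j < n → (G.Adj (g i) (g j) ↔ D i j)) {x : ℕ} (hx : x < n)
    (h : ¬ (G.induce {g x}ᶜ).Preconnected) : IsCutLabel n D x := by
  have hne : ∀ i, i < n → i ≠ x → g i ∈ ({g x}ᶜ : Set V) := fun i hi hix h' => hix (hg hi hx h')
  have h1 := mt SimpleGraph.preconnected_induce_of_prop h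
  push Not at h1
  obtain ⟨c, hc, u, hu, v, hv, huv⟩ := h1
  have hu' : u ∈ g '' Set.Iio n := hsurj ▸ trivial
  have hv' : v ∈ g '' Set.Iio n := hsurj ▸ trivial
  obtain ⟨i, hi, rfl⟩ := hu'
  obtain ⟨j, hj, rfl⟩ := hv'
  have hix : i ≠ x := by rintro rfl; exact hu rfl
  have hjx : j ≠ x := by rintro rfl; exact hv rfl
  refine ⟨fun k => c (g k), fun k l hkl hl hk' hl' hkl' =>
    hc _ (hne k (hkl.trans hl) hk') _ (hne l hl hl') ((hD k l hkl hl).2 hkl'), ?_⟩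
  rcases huv with ⟨h2, h3⟩ | ⟨h2, h3⟩
  · exact ⟨i, hi, j, hj, hix, hjx, h2, h3⟩
  · exact ⟨j, hj, i, hi, hjx, hix, h3, h2⟩

/-- If `S` has four elements and every connected vertex set containing `S` is everything, then `G`
is the union of a shortest path between two elements of `S`, of a shortest path from a third element
to the first path, and of a shortest path from the fourth element to these two paths. Unless the
first two paths suffice, every vertex is a cut vertex except the four elements of `S`, which are the
ends of these paths. -/
theorem exists_threePaths_model {V : Type*} [Fintype V] {G : SimpleGraph V} (hG : G.Connected)
    {n : ℕ} (hn : Fintype.card V = n) {S : Finset V} (hS4 : S.card = 4)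
    (hS : ∀ W : Set V, (S : Set V) ⊆ W → (G.induce W).Preconnected → W = Set.univ) :
    ∃ (p b : ℕ) (N₁ N₂ : ℕ → Prop), HasModel G n (threePaths p b N₁ N₂) ∧ 2 ≤ p ∧ p + b ≤ n ∧
      (0 < b → (∃ k, N₁ k) ∧ (∀ k, N₁ k → k < p) ∧ ∀ k m, N₁ k → N₁ m → m ≤ k + 2) ∧
      (b = 0 → p = n) ∧
      (p + b < n → (∃ k, N₂ k) ∧ (∀ k, N₂ k → k < p + b) ∧
        ∀ x < n, x ≠ 0 → x ≠ p - 1 → x ≠ p + b - 1 → x ≠ n - 1 →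
          IsCutLabel n (threePaths p b N₁ N₂) x) := by
  classical
  obtain ⟨s₁, hs₁, s₂, hs₂, hs₁₂⟩ := Finset.one_lt_card.1 (by omega : 1 < S.card)
  obtain ⟨b₁, g₁, hb₁, hg₁0, g₁_inj, g₁_last, ⟨i₁, hi₁, g₁_adj⟩, g₁_path, g₁_dist, g₁_dist'⟩ :=
    exists_extension_by_path hG (g := fun _ => s₁) (m := 1) (s := s₂) one_pos
      (fun i hi j hj _ => by simp at hi hj; omega) (by simpa using hs₁₂.symm)
  obtain rfl : i₁ = 0 := by omega
  replace hg₁0 : g₁ 0 = s₁ := hg₁0 0 one_pos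
  generalize hp : 1 + b₁ = p at *
  have hp2 : 2 ≤ p := by omega
  have path₁ : ∀ i j, i < j → j < p → (G.Adj (g₁ i) (g₁ j) ↔ i + 1 = j) := by
    intro i j hij hj
    rcases Nat.lt_or_ge 1 j with h | h
    · exact g₁_path i j hij h hj
    · obtain rfl : j = 1 := by omega
      obtain rfl : i = 0 := by omega
      simpa using g₁_adj
  have dist₁ : ∀ i j, i < j → j < p → j - i ≤ G.dist (g₁ i) (g₁ j) := by
    intro i j hij hj
    rcases Nat.eq_zero_or_pos i with rfl | h
    · have := g₁_dist' 0 one_pos j (by omega) hj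
      omega
    · exact (g₁_dist i j h hij.le hj).ge
  have conn₁ : ∀ j, 0 < j → j < p → ∃ i < j, G.Adj (g₁ i) (g₁ j) := fun j h0 hj =>
    ⟨j - 1, by omega, (path₁ _ _ (by omega) hj).2 (by omega)⟩
  by_cases hcov₁ : (S : Set V) ⊆ g₁ '' Set.Iio p
  · have huniv := hS _ hcov₁ (preconnected_induce_image conn₁)
    have hpn : p = n := by rw [← hn, card_eq_of_enumeration g₁_inj huniv]
    refine ⟨p, 0, fun _ => False, fun _ => False, ?_, hp2, by omega, by omega, fun _ => hpn,
      by omega⟩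
    rw [← hpn]
    refine hasModel_of_enumeration g₁_inj huniv fun i j hij hj => ?_
    rw [path₁ i j hij hj, threePaths, if_neg (by omega), if_neg (by omega)]
  obtain ⟨s, hs, hsg⟩ := Set.not_subset.1 hcov₁
  obtain ⟨b, g₂, hb, g₂_old, g₂_inj, g₂_last, ⟨i₂, hi₂, g₂_adj⟩, g₂_path, -, -⟩ :=
    exists_extension_by_path hG (by omega) g₁_inj hsg
  have window : ∀ k m, G.Adj (g₂ k) (g₂ p) → G.Adj (g₂ m) (g₂ p) → k < p → m < p → m ≤ k + 2 := by
    intro k m hk hm hkp hmp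
    by_contra! h
    have h1 := dist₁ k m (by omega) hmp
    rw [← g₂_old k hkp, ← g₂_old m hmp] at h1
    have h2 := hG.dist_triangle (u := g₂ k) (v := g₂ p) (w := g₂ m)
    rw [SimpleGraph.dist_eq_one_iff_adj.2 hk, SimpleGraph.dist_eq_one_iff_adj.2 hm.symm] at h2
    omega
  have path₂ : ∀ i j, i < j → j < p + b → j ≠ p → (G.Adj (g₂ i) (g₂ j) ↔ i + 1 = j) := by
    intro i j hij hj hjp
    rcases Nat.lt_or_ge p j with h | h
    · exact g₂_path i j hij h hj
    · rw [g₂_old i (by omega), g₂_old j (by omega)]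
      exact path₁ i j hij (by omega)
  have conn₂ : ∀ j, 0 < j → j < p + b → ∃ i < j, G.Adj (g₂ i) (g₂ j) := by
    intro j h0 hj
    rcases eq_or_ne j p with rfl | h
    · exact ⟨i₂, hi₂, g₂_adj⟩
    · exact ⟨j - 1, by omega, (path₂ _ _ (by omega) hj h).2 (by omega)⟩
  by_cases hcov₂ : (S : Set V) ⊆ g₂ '' Set.Iio (p + b)
  · have huniv := hS _ hcov₂ (preconnected_induce_image conn₂)
    have hpn : p + b = n := by rw [← hn, card_eq_of_enumeration g₂_inj huniv]
    refine ⟨p, b, fun k => k < p ∧ G.Adj (g₂ k) (g₂ p), fun _ => False, ?_, hp2, by omega,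
      fun _ => ⟨⟨i₂, hi₂, g₂_adj⟩, fun k hk => hk.1,
        fun k m hk hm => window k m hk.2 hm.2 hk.1 hm.1⟩, by omega, by omega⟩
    rw [← hpn]
    refine hasModel_of_enumeration g₂_inj huniv fun i j hij hj => ?_
    unfold threePaths
    split_ifs with h1 h2
    · obtain rfl := h1.1
      exact ⟨fun h => ⟨hij, h⟩, fun h => h.2⟩
    · omega
    · exact path₂ i j hij hj (by omega)
  obtain ⟨s', hs', hsg'⟩ := Set.not_subset.1 hcov₂
  obtain ⟨c, g, hc, g_old, g_inj, g_last, ⟨i₃, hi₃, g_adj⟩, g_path, -, -⟩ :=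
    exists_extension_by_path hG (by omega) g₂_inj hsg'
  have path : ∀ i j, i < j → j < p + b + c → j ≠ p → j ≠ p + b →
      (G.Adj (g i) (g j) ↔ i + 1 = j) := by
    intro i j hij hj hjp hjb
    rcases Nat.lt_or_ge (p + b) j with h | h
    · exact g_path i j hij h hj
    · rw [g_old i (by omega), g_old j (by omega)]
      exact path₂ i j hij (by omega) hjp
  have conn : ∀ j, 0 < j → j < p + b + c → ∃ i < j, G.Adj (g i) (g j) := by
    intro j h0 hj
    rcases eq_or_ne j (p + b) with rfl | h
    · exact ⟨i₃, hi₃, g_adj⟩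
    · rcases eq_or_ne j p with rfl | h'
      · refine ⟨i₂, hi₂, ?_⟩
        rw [g_old _ (by omega), g_old _ (by omega)]
        exact g₂_adj
      · exact ⟨j - 1, by omega, (path _ _ (by omega) hj h' h).2 (by omega)⟩
  have e0 : g 0 = s₁ := by rw [g_old _ (by omega), g₂_old _ (by omega), hg₁0]
  have e1 : g (p - 1) = s₂ := by rw [g_old _ (by omega), g₂_old _ (by omega), g₁_last]
  have e2 : g (p + b - 1) = s := by rw [g_old _ (by omega), g₂_last]
  have hne : ∀ i j, i < j → j < p + b + c → g i ≠ g j := fun i j hij hj h =>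
    hij.ne (g_inj (show i < p + b + c by omega) hj h)
  have hSeq : ({g 0, g (p - 1), g (p + b - 1), g (p + b + c - 1)} : Finset V) = S := by
    refine Finset.eq_of_subset_of_card_le ?_ ?_
    · rw [e0, e1, e2, g_last]
      intro v hv
      simp only [Finset.mem_insert, Finset.mem_singleton] at hv
      rcases hv with rfl | rfl | rfl | rfl <;> assumption
    · rw [hS4, Finset.card_insert_of_notMem, Finset.card_insert_of_notMem,
        Finset.card_insert_of_notMem, Finset.card_singleton]
      all_goals
        simp only [Finset.mem_insert, Finset.mem_singleton, not_or]
      · exact hne _ _ (by omega) (by omega)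
      · exact ⟨hne _ _ (by omega) (by omega), hne _ _ (by omega) (by omega)⟩
      · exact ⟨hne _ _ (by omega) (by omega), hne _ _ (by omega) (by omega),
          hne _ _ (by omega) (by omega)⟩
  have huniv : g '' Set.Iio (p + b + c) = Set.univ := by
    refine hS _ ?_ (preconnected_induce_image conn)
    rw [← hSeq]
    intro v hv
    simp only [Finset.coe_insert, Finset.coe_singleton, Set.mem_insert_iff,
      Set.mem_singleton_iff] at hv
    rcases hv with rfl | rfl | rfl | rfl <;> exact ⟨_, by simp; omega, rfl⟩
  have hpn : p + b + c = n := by rw [← hn, card_eq_of_enumeration g_inj huniv]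
  have hD : ∀ i j, i < j → j < p + b + c → (G.Adj (g i) (g j) ↔
      threePaths p b (fun k => k < p ∧ G.Adj (g k) (g p))
        (fun k => k < p + b ∧ G.Adj (g k) (g (p + b))) i j) := by
    intro i j hij hj
    unfold threePaths
    split_ifs with h1 h2
    · obtain rfl := h1.1
      exact ⟨fun h => ⟨hij, h⟩, fun h => h.2⟩
    · subst h2
      exact ⟨fun h => ⟨hij, h⟩, fun h => h.2⟩
    · exact path i j hij hj (by omega) h2
  rw [← hpn]
  refine ⟨p, b, _, _, hasModel_of_enumeration g_inj huniv hD, hp2, by omega, fun _ => ?_, by omega,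
    fun _ => ?_⟩
  · refine ⟨⟨i₂, hi₂, ?_⟩, fun k hk => hk.1, fun k m hk hm => ?_⟩
    · rw [g_old _ (by omega), g_old _ (by omega)]
      exact g₂_adj
    · obtain ⟨hk1, hk2⟩ := hk
      obtain ⟨hm1, hm2⟩ := hm
      rw [g_old _ (by omega), g_old _ (by omega)] at hk2 hm2
      exact window k m hk2 hm2 hk1 hm1
  · refine ⟨⟨i₃, hi₃, g_adj⟩, fun k hk => hk.1, fun x hx h0 h1 h2 h3 =>
      isCutLabel_of_enumeration g_inj huniv hD hx fun hpre => ?_⟩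
    have hsub : (S : Set V) ⊆ {g x}ᶜ := by
      rw [← hSeq]
      intro v hv
      simp only [Finset.coe_insert, Finset.coe_singleton, Set.mem_insert_iff,
        Set.mem_singleton_iff] at hv
      have hx' : ∀ y, y < p + b + c → x ≠ y → g y ∈ ({g x}ᶜ : Set V) := fun y hy hxy h =>
        hxy (g_inj hy hx h).symm
      rcases hv with rfl | rfl | rfl | rfl <;> exact hx' _ (by omega) (by assumption)
    have : g x ∈ ({g x}ᶜ : Set V) := hS _ hsub hpre ▸ trivial
    exact this rfl

/-! ### Restrictions imposed by the cut vertices -/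

theorem iff_of_iff_succ {c : ℕ → Prop} {l m : ℕ} (h : ∀ k, l ≤ k → k < m → (c k ↔ c (k + 1))) :
    ∀ k, l ≤ k → k ≤ m → (c k ↔ c l) := by
  intro k hlk
  induction k, hlk using Nat.le_induction with
  | base => exact fun _ => Iff.rfl
  | succ k hk ih => exact fun hm => (h k hk (by omega)).symm.trans (ih (by omega))

section

variable {n p b : ℕ} {N₁ N₂ : ℕ → Prop}

/-- When an inner vertex `x` of the first path is a cut vertex, the two parts of this path, the
second path and the third path cannot all be linked to each other. -/
theorem IsCutLabel.exists_of_mem_first {x : ℕ} (h : IsCutLabel n (threePaths p b N₁ N₂) x)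
    (hx0 : 0 < x) (hx : x + 1 < p) (hpb : p + b < n) :
    ∃ c : ℕ → Prop, (∀ k < x, c k ↔ c 0) ∧ (∀ k, x < k → k < p → (c k ↔ c (p - 1))) ∧
      (∀ k, p ≤ k → k < p + b → (c k ↔ c p)) ∧
      (∀ k < p, 0 < b → k ≠ x → N₁ k → (c k ↔ c p)) ∧
      (∀ k < p + b, k ≠ x → N₂ k → (c k ↔ c (p + b))) ∧
      ¬ ((c (p - 1) ↔ c 0) ∧ (0 < b → (c p ↔ c 0)) ∧ (c (p + b) ↔ c 0)) := by
  obtain ⟨c, hc, i, hi, j, hj, hix, hjx, hci, hcj⟩ := h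
  have hstep : ∀ k, k + 1 < n → k ≠ x → k + 1 ≠ x → k + 1 ≠ p → k + 1 ≠ p + b →
      (c k ↔ c (k + 1)) := fun k h1 h2 h3 h4 h5 => hc k (k + 1) (by omega) h1 h2 h3 (by
    rw [threePaths, if_neg (by omega), if_neg h5])
  have c1 : ∀ k < x, c k ↔ c 0 := fun k hk =>
    iff_of_iff_succ (l := 0) (m := x - 1)
      (fun k _ _ => hstep k (by omega) (by omega) (by omega) (by omega) (by omega)) k
      (by omega) (by omega)
  have c2 : ∀ k, x < k → k < p → (c k ↔ c (x + 1)) := fun k hk hk' =>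
    iff_of_iff_succ (l := x + 1) (m := p - 1)
      (fun k _ _ => hstep k (by omega) (by omega) (by omega) (by omega) (by omega)) k
      (by omega) (by omega)
  have c3 : ∀ k, p ≤ k → k < p + b → (c k ↔ c p) := fun k hk hk' =>
    iff_of_iff_succ (l := p) (m := p + b - 1)
      (fun k _ _ => hstep k (by omega) (by omega) (by omega) (by omega) (by omega)) k
      (by omega) (by omega)
  have c4 : ∀ k, p + b ≤ k → k < n → (c k ↔ c (p + b)) := fun k hk hk' =>
    iff_of_iff_succ (l := p + b) (m := n - 1)
      (fun k _ _ => hstep k (by omega) (by omega) (by omega) (by omega) (by omega)) k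
      (by omega) (by omega)
  refine ⟨c, c1, fun k hk hk' => (c2 k hk hk').trans (c2 (p - 1) (by omega) (by omega)).symm, c3,
    fun k hk hb hkx hN => hc k p hk (by omega) hkx (by omega) ?_,
    fun k hk hkx hN => hc k (p + b) hk hpb hkx (by omega) ?_, ?_⟩
  · rwa [threePaths, if_pos ⟨rfl, hb⟩]
  · rwa [threePaths, if_neg (by omega), if_pos rfl]
  · rintro ⟨h1, h2, h3⟩
    have hall : ∀ k < n, k ≠ x → (c k ↔ c 0) := by
      intro k hk hkx
      rcases lt_or_ge k p with h4 | h4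
      · rcases lt_or_gt_of_ne hkx with h5 | h5
        · exact c1 k h5
        · rw [c2 k h5 h4, ← c2 (p - 1) (by omega) (by omega), h1]
      · rcases lt_or_ge k (p + b) with h5 | h5
        · rw [c3 k h4 h5, h2 (by omega)]
        · rw [c4 k h5 hk, h3]
    exact hcj ((hall j hj hjx).2 ((hall i hi hix).1 hci))

/-- A vertex of the second path is not a cut vertex if the third path bypasses it. -/
theorem not_isCutLabel_of_bypass {x u w : ℕ} (hpx : p ≤ x) (hux : u < x) (hxw : x < w)
    (hw : w < p + b) (hpb : p + b < n) (hu₂ : N₂ u) (hw₂ : N₂ w) (h₁ : ∃ k, N₁ k)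
    (h₁' : ∀ k, N₁ k → k < p) : ¬ IsCutLabel n (threePaths p b N₁ N₂) x := by
  rintro ⟨c, hc, i, hi, j, hj, hix, hjx, hci, hcj⟩
  obtain ⟨m, hm⟩ := h₁
  have hmp := h₁' m hm
  have hstep : ∀ k, k + 1 < n → k ≠ x → k + 1 ≠ x → k + 1 ≠ p → k + 1 ≠ p + b →
      (c k ↔ c (k + 1)) := fun k h1 h2 h3 h4 h5 => hc k (k + 1) (by omega) h1 h2 h3 (by
    rw [threePaths, if_neg (by omega), if_neg h5])
  have c1 : ∀ k < p, c k ↔ c 0 := fun k hk =>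
    iff_of_iff_succ (l := 0) (m := p - 1)
      (fun k _ _ => hstep k (by omega) (by omega) (by omega) (by omega) (by omega)) k
      (by omega) (by omega)
  have c2 : ∀ k, p ≤ k → k < x → (c k ↔ c p) := fun k hk hk' =>
    iff_of_iff_succ (l := p) (m := x - 1)
      (fun k _ _ => hstep k (by omega) (by omega) (by omega) (by omega) (by omega)) k
      (by omega) (by omega)
  have c3 : ∀ k, x < k → k < p + b → (c k ↔ c (x + 1)) := fun k hk hk' =>
    iff_of_iff_succ (l := x + 1) (m := p + b - 1)
      (fun k _ _ => hstep k (by omega) (by omega) (by omega) (by omega) (by omega)) k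
      (by omega) (by omega)
  have c4 : ∀ k, p + b ≤ k → k < n → (c k ↔ c (p + b)) := fun k hk hk' =>
    iff_of_iff_succ (l := p + b) (m := n - 1)
      (fun k _ _ => hstep k (by omega) (by omega) (by omega) (by omega) (by omega)) k
      (by omega) (by omega)
  have d1 : p < x → (c m ↔ c p) := fun hx => hc m p hmp (by omega) (by omega) (by omega) (by
    rwa [threePaths, if_pos ⟨rfl, by omega⟩])
  have d2 : ∀ k < p + b, k ≠ x → N₂ k → (c k ↔ c (p + b)) := fun k hk hkx hN =>
    hc k (p + b) hk hpb hkx (by omega) (by rwa [threePaths, if_neg (by omega), if_pos rfl])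
  have e1 : ∀ k, k < x → (c k ↔ c 0) := by
    intro k hk
    rcases lt_or_ge k p with h | h
    · exact c1 k h
    · rw [c2 k h hk, ← d1 (by omega), c1 m hmp]
  have e2 : c (p + b) ↔ c 0 := by rw [← d2 u (by omega) (by omega) hu₂, e1 u hux]
  have hall : ∀ k < n, k ≠ x → (c k ↔ c 0) := by
    intro k hk hkx
    rcases lt_or_gt_of_ne hkx with h | h
    · exact e1 k h
    · rcases lt_or_ge k (p + b) with h' | h'
      · rw [c3 k h h', ← c3 w hxw hw, d2 w hw (by omega) hw₂, e2]
      · rw [c4 k h' hk, e2]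
  exact hcj ((hall j hj hjx).2 ((hall i hi hix).1 hci))

/-- An inner vertex `x` of the first path that is bypassed by the third path is the only neighbour
of the second path on the first one, and the third path does not touch the second one. -/
theorem IsCutLabel.of_bypass {x u w : ℕ} (h : IsCutLabel n (threePaths p b N₁ N₂) x)
    (hpb : p + b < n) (hb : 0 < b) (hux : u < x) (hxw : x < w) (hw : w < p) (hu₂ : N₂ u)
    (hw₂ : N₂ w) : (∀ k < p, N₁ k → k = x) ∧ ∀ k < p + b, N₂ k → k < p := by
  obtain ⟨c, c1, c2, c3, c4, c5, hne⟩ := h.exists_of_mem_first (by omega) (by omega) hpb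
  have d1 := c1 u hux
  have d2 := c2 w hxw hw
  have d3 := c5 u (by omega) (by omega) hu₂
  have d4 := c5 w (by omega) (by omega) hw₂
  constructor
  · intro k hk hk₁
    by_contra hkx
    have d5 := c4 k hk hb hkx hk₁
    rcases lt_or_gt_of_ne hkx with hlt | hgt
    · have d6 := c1 k hlt
      grind
    · have d6 := c2 k hgt hk
      grind
  · intro k hk hk₂
    by_contra! hkp
    have d5 := c5 k hk (by omega) hk₂
    have d6 := c3 k hkp hk
    grind

/-- If the third path meets the second path and the first one, no inner vertex of the first path
separates the neighbours of the second and of the third path on the first one. -/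
theorem not_isCutLabel_of_separates {x u w m : ℕ} (hpb : p + b < n) (hx0 : 0 < x) (hx : x + 1 < p)
    (hu : u < p) (hm : m < p) (hpw : p ≤ w) (hw : w < p + b) (hu₂ : N₂ u) (hw₂ : N₂ w) (hm₁ : N₁ m)
    (hsep : u < x ∧ x < m ∨ m < x ∧ x < u) : ¬ IsCutLabel n (threePaths p b N₁ N₂) x := by
  intro h
  obtain ⟨c, c1, c2, c3, c4, c5, hne⟩ := h.exists_of_mem_first hx0 hx hpb
  have d1 := c5 u (by omega) (by omega) hu₂
  have d2 := c5 w hw (by omega) hw₂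
  have d3 := c4 m hm (by omega) (by omega) hm₁
  have d4 := c3 w hpw hw
  rcases hsep with ⟨h1, h2⟩ | ⟨h1, h2⟩
  · have d5 := c1 u h1
    have d6 := c2 m h2 hm
    grind
  · have d5 := c1 m h1
    have d6 := c2 u h2 hu
    grind

/-- If an inner vertex `x` of the first path is a cut vertex bypassed by the second path, then the
third path is joined to `x` only. -/
theorem IsCutLabel.eq_of_second_path {x u w k : ℕ} (h : IsCutLabel n (threePaths p b N₁ N₂) x)
    (hpb : p + b < n) (hb : 0 < b) (hux : u < x) (hxw : x < w) (hw : w < p) (hu₁ : N₁ u)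
    (hw₁ : N₁ w) (hk : k < p + b) (hk₂ : N₂ k) : k = x := by
  by_contra hkx
  obtain ⟨c, c1, c2, c3, c4, c5, hne⟩ := h.exists_of_mem_first (by omega) (by omega) hpb
  have d1 := c1 u hux
  have d2 := c2 w hxw hw
  have d3 := c4 u (by omega) hb (by omega) hu₁
  have d4 := c4 w hw hb (by omega) hw₁
  have d5 := c5 k hk hkx hk₂
  rcases lt_or_ge k p with h1 | h1
  · rcases lt_or_gt_of_ne hkx with hlt | hgt
    · have d6 := c1 k hlt
      grind
    · have d6 := c2 k hgt h1
      grind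
  · have d6 := c3 k h1 hk
    grind

end

/-! ### The possible positions of the second and the third path -/

section

variable {V : Type*} {G : SimpleGraph V} {n p b i : ℕ}

/-- Both further paths are joined to one vertex or to two consecutive vertices of the first path. -/
theorem isListed_of_both_on_first {e u e₂ : ℕ} (he : e ≤ 1) (he₂ : e₂ ≤ 1)
    (h : HasModel G n (threePaths p b (fun k => i ≤ k ∧ k ≤ i + e) (fun k => u ≤ k ∧ k ≤ u + e₂)))
    (hpb : p + b ≤ n) (hb : 0 < b) (hc : 0 < e₂ → p + b < n) (hi : i + e < p) (hu : u + e₂ < p) :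
    IsListed G n := by
  by_cases h1 : i + e ≤ u
  · exact isListed_of_dumbbell he he₂ h hpb (fun _ => hb) hc h1 hu
  by_cases h2 : u + e₂ ≤ i
  · refine isListed_of_dumbbell (i := p - 1 - (i + e)) (u := p - 1 - (u + e₂)) he he₂
      ((h.reverse hpb).congr (threePaths_congr rfl rfl ?_ ?_)) hpb (fun _ => hb) hc (by omega)
      (by omega)
    · intros; omega
    · intro _ k hk
      split_ifs <;> omega
  · obtain ⟨rfl, rfl, rfl⟩ : e = 1 ∧ e₂ = 1 ∧ u = i := by omega
    exact isListed_of_two_triangles_on_edge h (hc one_pos) hb hi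

/-- The third path is joined to the second path only; exchanging the second path with the end of the
first one reduces this to `isListed_of_dumbbell`. -/
theorem isListed_of_third_on_second {e u e₂ : ℕ} (he : e ≤ 1) (he₂ : e₂ ≤ 1)
    (h : HasModel G n (threePaths p b (fun k => i ≤ k ∧ k ≤ i + e) (fun k => u ≤ k ∧ k ≤ u + e₂)))
    (hpb : p + b < n) (hi : i + e < p) (hpu : p ≤ u) (hu : u + e₂ < p + b) : IsListed G n := by
  have h' := h.swap_legs hpb.le he hi (by omega)
  refine isListed_of_dumbbell (u := u - p + (i + 1)) he he₂
    (h'.congr (threePaths_congr rfl rfl (fun _ _ _ => Iff.rfl) ?_)) (by omega) (by omega)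
    (by omega) (by omega) (by omega)
  intro _ k hk
  split_ifs <;> omega

/-- The third path forms a triangle with the edge from the first path to the second one. -/
theorem isListed_of_third_on_first_edge_of_second
    (h : HasModel G n (threePaths p b (fun k => i ≤ k ∧ k ≤ i + 0) (fun k => k = i ∨ k = p)))
    (hpb : p + b < n) (hb : 0 < b) (hi : i < p) : IsListed G n := by
  have h' := h.swap_legs hpb.le zero_le_one hi hb
  refine isListed_of_dumbbell (u := i) zero_le_one le_rfl
    (h'.congr (threePaths_congr rfl rfl (fun _ _ _ => Iff.rfl) ?_)) (by omega) (by omega)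
    (by omega) (by omega) (by omega)
  intro _ k hk
  split_ifs <;> omega

/-- A four-cycle through `i - 1`, `i`, `i + 1`, with the chord at `i` if `t = 1`. -/
theorem isListed_of_third_around {t : ℕ} (ht : t ≤ 1)
    (h : HasModel G n (threePaths p b (fun k => i ≤ k ∧ k ≤ i + 0)
      (fun k => k + 1 = i ∨ k = i + 1 ∨ k = i ∧ t = 1)))
    (hpb : p + b < n) (hi : 0 < i) (hip : i + 1 < p) : IsListed G n := by
  obtain rfl | rfl : t = 0 ∨ t = 1 := by omega
  · refine isListed_of_four_cycle (h.congr (threePaths_congr rfl rfl ?_ ?_)) hpb hi hip <;> intros <;>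
      omega
  · refine isListed_of_four_cycle_chord (h.congr (threePaths_congr rfl rfl ?_ ?_)) hpb hi hip <;>
      intros <;> omega

/-- The third path is joined to the neighbours of `i` on the left part of the first path and on the
second path, and to `i` itself if `t = 1`. -/
theorem isListed_of_third_around_left {t : ℕ} (ht : t ≤ 1)
    (h : HasModel G n (threePaths p b (fun k => i ≤ k ∧ k ≤ i + 0)
      (fun k => k + 1 = i ∨ k = p ∨ k = i ∧ t = 1)))
    (hpb : p + b < n) (hb : 0 < b) (hi : 0 < i) (hip : i < p) : IsListed G n := by
  have h' := h.swap_legs hpb.le zero_le_one hip hb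
  refine isListed_of_third_around ht (h'.congr (threePaths_congr rfl rfl (fun _ _ _ => Iff.rfl) ?_))
    (by omega) hi (by omega)
  intro _ k hk
  split_ifs <;> omega

theorem isListed_of_third_around_right {t : ℕ} (ht : t ≤ 1)
    (h : HasModel G n (threePaths p b (fun k => i ≤ k ∧ k ≤ i + 0)
      (fun k => k = i + 1 ∨ k = p ∨ k = i ∧ t = 1)))
    (hpb : p + b < n) (hb : 0 < b) (hip : i + 1 < p) : IsListed G n := by
  refine isListed_of_third_around_left (i := p - 1 - i) ht
    ((h.reverse hpb.le).congr (threePaths_congr rfl rfl ?_ ?_)) hpb hb (by omega) (by omega)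
  · intros; omega
  · intro _ k hk
    split_ifs <;> omega

/-- The third path is joined to the side of the triangle between `i` and the second path. -/
theorem isListed_of_third_on_left_side
    (h : HasModel G n (threePaths p b (fun k => i ≤ k ∧ k ≤ i + 1) (fun k => k = i ∨ k = p)))
    (hpb : p + b < n) (hb : 0 < b) (hip : i + 1 < p) : IsListed G n := by
  have h' := h.swap_legs hpb.le le_rfl hip hb
  refine isListed_of_two_triangles_on_edge
    (h'.congr (threePaths_congr rfl rfl (fun _ _ _ => Iff.rfl) ?_)) (by omega) (by omega) (by omega)
  intro _ k hk
  split_ifs <;> omega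

theorem isListed_of_third_on_right_side
    (h : HasModel G n (threePaths p b (fun k => i ≤ k ∧ k ≤ i + 1) (fun k => k = i + 1 ∨ k = p)))
    (hpb : p + b < n) (hb : 0 < b) (hip : i + 1 < p) : IsListed G n := by
  refine isListed_of_third_on_left_side (i := p - 2 - i)
    ((h.reverse hpb.le).congr (threePaths_congr rfl rfl ?_ ?_)) hpb hb (by omega)
  · intros; omega
  · intro _ k hk
    split_ifs <;> omega

/-- A set of natural numbers with least element `u` contained in `{u, u + 1}`. -/
theorem exists_interval_of_le_succ {N : ℕ → Prop} {u : ℕ} (hu : N u) (h : ∀ k, N k → u ≤ k)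
    (h' : ∀ k, N k → k ≤ u + 1) : ∃ e ≤ 1, N (u + e) ∧ ∀ k, N k ↔ u ≤ k ∧ k ≤ u + e := by
  by_cases h1 : N (u + 1)
  · refine ⟨1, le_rfl, h1, fun k => ⟨fun hk => ⟨h k hk, h' k hk⟩, fun hk => ?_⟩⟩
    obtain rfl | rfl : k = u ∨ k = u + 1 := by omega
    exacts [hu, h1]
  · refine ⟨0, zero_le_one, hu, fun k => ⟨fun hk => ⟨h k hk, ?_⟩, fun hk => ?_⟩⟩
    · have := h' k hk
      have : k ≠ u + 1 := by rintro rfl; exact h1 hk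
      omega
    · obtain rfl : k = u := by omega
      exact hu

theorem exists_least {N : ℕ → Prop} (h : ∃ k, N k) : ∃ u, N u ∧ ∀ k, N k → u ≤ k := by
  classical
  exact ⟨Nat.find h, Nat.find_spec h, fun k hk => Nat.find_min' h hk⟩

/-- The case of a second path joined to one vertex of the first path, or to two consecutive ones. -/
theorem isListed_of_model_of_le_one {e : ℕ} {N₂ : ℕ → Prop} (he : e ≤ 1)
    (h : HasModel G n (threePaths p b (fun k => i ≤ k ∧ k ≤ i + e) N₂)) (hpb : p + b ≤ n)
    (hb : 0 < b) (hi : i + e < p)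
    (h₂ : p + b < n → (∃ k, N₂ k) ∧ (∀ k, N₂ k → k < p + b) ∧
      ∀ x < n, x ≠ 0 → x ≠ p - 1 → x ≠ p + b - 1 → x ≠ n - 1 →
        IsCutLabel n (threePaths p b (fun k => i ≤ k ∧ k ≤ i + e) N₂) x) : IsListed G n := by
  rcases hpb.eq_or_lt with hpn | hpn
  · exact isListed_of_both_on_first (u := i) he zero_le_one
      (h.congr (threePaths_congr rfl rfl (fun _ _ _ => Iff.rfl) (by omega))) hpb hb (by omega) hi
      (by omega)
  obtain ⟨h₂ne, h₂lt, hcut⟩ := h₂ hpn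
  by_cases hQ : ∃ w, N₂ w ∧ p ≤ w
  · obtain ⟨w, hw₂, hpw⟩ := hQ
    have hwb := h₂lt w hw₂
    by_cases hP : ∃ u, N₂ u ∧ u < p
    · obtain ⟨u, hu₂, hup⟩ := hP
      have hQp : ∀ w, N₂ w → p ≤ w → w = p := by
        intro w hw₂ hpw
        have hwb := h₂lt w hw₂
        by_contra hne
        exact not_isCutLabel_of_bypass (x := w - 1) (by omega) (by omega : u < w - 1) (by omega) hwb
          hpn hu₂ hw₂ ⟨i, by omega⟩ (by intros; omega)
          (hcut _ (by omega) (by omega) (by omega) (by omega) (by omega))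
      obtain rfl := hQp w hw₂ hpw
      have hlow : ∀ u, N₂ u → u < w → i + e ≤ u + 1 := by
        intro u hu₂ hup
        by_contra hlt
        exact not_isCutLabel_of_separates (x := u + 1) (m := i + e) hpn (by omega) (by omega) hup hi
          hpw hwb hu₂ hw₂ (by omega) (by omega)
          (hcut _ (by omega) (by omega) (by omega) (by omega) (by omega))
      have hupp : ∀ u, N₂ u → u < w → u ≤ i + 1 := by
        intro u hu₂ hup
        by_contra hlt
        exact not_isCutLabel_of_separates (x := i + 1) (m := i) hpn (by omega) (by omega) hup
          (by omega) hpw hwb hu₂ hw₂ (by omega) (by omega)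
          (hcut _ (by omega) (by omega) (by omega) (by omega) (by omega))
      have hsub : ∀ k, N₂ k → k = w ∨ k < w ∧ i + e ≤ k + 1 ∧ k ≤ i + 1 := by
        intro k hk
        rcases lt_or_ge k w with h1 | h1
        · exact Or.inr ⟨h1, hlow k hk h1, hupp k hk h1⟩
        · exact Or.inl (hQp k hk h1)
      obtain rfl | rfl : e = 0 ∨ e = 1 := by omega
      · obtain ⟨t, ht, hti⟩ : ∃ t ≤ 1, (N₂ i ↔ t = 1) := by
          by_cases hN : N₂ i
          · exact ⟨1, le_rfl, by simpa using hN⟩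
          · exact ⟨0, zero_le_one, by simpa using hN⟩
        by_cases hr : i + 1 < w ∧ N₂ (i + 1)
        · have hl : ∀ k, N₂ k → k + 1 ≠ i := by
            intro k hk hki
            have := (hcut i (by omega) (by omega) (by omega) (by omega) (by omega)).of_bypass hpn hb
              (by omega : k < i) (Nat.lt_succ_self i) hr.1 hk hr.2
            exact (this.2 w hwb hw₂).false
          refine isListed_of_third_around_right ht
            (h.congr (threePaths_congr rfl rfl (fun _ _ _ => Iff.rfl) ?_)) hpn hb hr.1
          intro _ k hk
          constructor
          · intro hk₂
            have h1 := hsub k hk₂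
            have h2 := hl k hk₂
            rcases eq_or_ne k i with rfl | h3
            · exact Or.inr (Or.inr ⟨rfl, hti.1 hk₂⟩)
            · omega
          · rintro (rfl | rfl | ⟨rfl, h1⟩)
            exacts [hr.2, hw₂, hti.2 h1]
        · by_cases hl : 0 < i ∧ N₂ (i - 1)
          · refine isListed_of_third_around_left ht
              (h.congr (threePaths_congr rfl rfl (fun _ _ _ => Iff.rfl) ?_)) hpn hb hl.1 hi
            intro _ k hk
            constructor
            · intro hk₂
              have h1 := hsub k hk₂
              rcases eq_or_ne k i with rfl | h3
              · exact Or.inr (Or.inr ⟨rfl, hti.1 hk₂⟩)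
              · have h2 : k < w → k ≠ i + 1 := by
                  rintro h4 rfl
                  exact hr ⟨h4, hk₂⟩
                omega
            · rintro (h1 | rfl | ⟨rfl, h1⟩)
              · obtain rfl : k = i - 1 := by omega
                exact hl.2
              · exact hw₂
              · exact hti.2 h1
          · have hki : ∀ k, N₂ k → k < w → k = i := by
              intro k hk₂ hk
              have h1 := hsub k hk₂
              have h2 : k ≠ i + 1 := by
                rintro rfl
                exact hr ⟨hk, hk₂⟩
              have h3 : k + 1 ≠ i := by
                rintro rfl
                exact hl ⟨by omega, hk₂⟩
              omega
            refine isListed_of_third_on_first_edge_of_second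
              (h.congr (threePaths_congr rfl rfl (fun _ _ _ => Iff.rfl) ?_)) hpn hb hi
            intro _ k hk
            constructor
            · intro hk₂
              have h1 := hsub k hk₂
              have h2 := hki k hk₂
              omega
            · rintro (rfl | rfl)
              · exact hki u hu₂ hup ▸ hu₂
              · exact hw₂
      · have hsub' : ∀ k, N₂ k → k = i ∨ k = i + 1 ∨ k = w := fun k hk => by
          have := hsub k hk
          omega
        by_cases h1 : N₂ i
        · by_cases h2 : N₂ (i + 1)
          · refine isListed_of_complete_four
              (h.congr (threePaths_congr rfl rfl (fun _ _ _ => Iff.rfl) ?_)) hpn hb hi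
            intro _ k hk
            constructor
            · intro hk₂
              have := hsub' k hk₂
              omega
            · intro h3
              obtain rfl | rfl | rfl : k = i ∨ k = i + 1 ∨ k = w := by omega
              exacts [h1, h2, hw₂]
          · refine isListed_of_third_on_left_side
              (h.congr (threePaths_congr rfl rfl (fun _ _ _ => Iff.rfl) ?_)) hpn hb hi
            intro _ k hk
            constructor
            · intro hk₂
              have h3 := hsub' k hk₂
              have h4 : k ≠ i + 1 := by rintro rfl; exact h2 hk₂
              omega
            · rintro (rfl | rfl)
              exacts [h1, hw₂]
        · have h2 : N₂ (i + 1) := by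
            rcases hsub' u hu₂ with rfl | rfl | rfl
            exacts [absurd hu₂ h1, hu₂, absurd hup (lt_irrefl _)]
          refine isListed_of_third_on_right_side
            (h.congr (threePaths_congr rfl rfl (fun _ _ _ => Iff.rfl) ?_)) hpn hb hi
          intro _ k hk
          constructor
          · intro hk₂
            have h3 := hsub' k hk₂
            have h4 : k ≠ i := by rintro rfl; exact h1 hk₂
            omega
          · rintro (rfl | rfl)
            exacts [h2, hw₂]
    · obtain ⟨u, hu₂, hu⟩ := exists_least h₂ne
      have hpu : p ≤ u := by
        by_contra hlt
        exact hP ⟨u, hu₂, by omega⟩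
      obtain ⟨e₂, he₂, hue, hiff⟩ := exists_interval_of_le_succ hu₂ hu (by
        intro k hk
        have hkb := h₂lt k hk
        by_contra hlt
        exact not_isCutLabel_of_bypass (x := u + 1) (by omega) (Nat.lt_succ_self u)
          (by omega : u + 1 < k) hkb hpn hu₂ hk ⟨i, by omega⟩ (by intros; omega)
          (hcut _ (by omega) (by omega) (by omega) (by omega) (by omega)))
      exact isListed_of_third_on_second he he₂
        (h.congr (threePaths_congr rfl rfl (fun _ _ _ => Iff.rfl) fun _ k _ => hiff k)) hpn hi hpu
        (h₂lt _ hue)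
  · have hlt : ∀ k, N₂ k → k < p := fun k hk => by
      by_contra! hle
      exact hQ ⟨k, hk, hle⟩
    obtain ⟨u, hu₂, hu⟩ := exists_least h₂ne
    have hbetween : ∀ k x, N₂ k → u < x → x < k → e = 0 ∧ x = i := by
      intro k x hk hux hxk
      have hkp := hlt k hk
      have := ((hcut x (by omega) (by omega) (by omega) (by omega) (by omega)).of_bypass hpn hb hux
        hxk hkp hu₂ hk).1
      have h1 := this i (by omega) (by omega)
      have h2 := this (i + e) (by omega) (by omega)
      omega
    by_cases h2 : ∀ k, N₂ k → k ≤ u + 1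
    · obtain ⟨e₂, he₂, hue, hiff⟩ := exists_interval_of_le_succ hu₂ hu h2
      exact isListed_of_both_on_first he he₂
        (h.congr (threePaths_congr rfl rfl (fun _ _ _ => Iff.rfl) fun _ k _ => hiff k)) hpb hb
        (fun _ => hpn) hi (hlt _ hue)
    · push Not at h2
      obtain ⟨m, hm, hmu⟩ := h2
      obtain ⟨rfl, hui⟩ := hbetween m (u + 1) hm (by omega) hmu
      have hle : ∀ k, N₂ k → k ≤ u + 2 := by
        intro k hk
        by_contra hlt
        have := hbetween k (u + 2) hk (by omega) (by omega)
        omega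
      obtain rfl : m = u + 2 := by have := hle m hm; omega
      have hm' := hlt _ hm
      obtain ⟨t, ht, hti⟩ : ∃ t ≤ 1, (N₂ i ↔ t = 1) := by
        by_cases hN : N₂ i
        · exact ⟨1, le_rfl, by simpa using hN⟩
        · exact ⟨0, zero_le_one, by simpa using hN⟩
      refine isListed_of_third_around ht
        (h.congr (threePaths_congr rfl rfl (fun _ _ _ => Iff.rfl) ?_)) hpn (by omega) (by omega)
      intro _ k hk
      constructor
      · intro hk₂
        have h3 := hu k hk₂
        have h4 := hle k hk₂
        rcases eq_or_ne k i with rfl | h5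
        · exact Or.inr (Or.inr ⟨rfl, hti.1 hk₂⟩)
        · omega
      · rintro (h3 | h3 | ⟨rfl, h3⟩)
        · obtain rfl : k = u := by omega
          exact hu₂
        · obtain rfl : k = u + 2 := by omega
          exact hm
        · exact hti.2 h3

/-- The second path is joined to vertices within a window of three. If both ends of a window of three
are used, the four-cycle so formed forces the third path to start at the middle vertex, and the second
and third path can be exchanged. -/
theorem isListed_of_model {N₁ N₂ : ℕ → Prop} (h : HasModel G n (threePaths p b N₁ N₂)) (hp : 2 ≤ p)
    (hpb : p + b ≤ n)
    (h₁ : 0 < b → (∃ k, N₁ k) ∧ (∀ k, N₁ k → k < p) ∧ ∀ k m, N₁ k → N₁ m → m ≤ k + 2)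
    (hb0 : b = 0 → p = n)
    (h₂ : p + b < n → (∃ k, N₂ k) ∧ (∀ k, N₂ k → k < p + b) ∧
      ∀ x < n, x ≠ 0 → x ≠ p - 1 → x ≠ p + b - 1 → x ≠ n - 1 →
        IsCutLabel n (threePaths p b N₁ N₂) x) : IsListed G n := by
  rcases Nat.eq_zero_or_pos b with rfl | hb
  · refine isListed_of_tree (i := 0) (u := 0) (h.congr (threePaths_congr rfl rfl ?_ ?_)) hpb le_rfl
      (by omega) <;> intros <;> omega
  obtain ⟨h₁ne, h₁lt, hwin⟩ := h₁ hb
  obtain ⟨i, hi₁, hi⟩ := exists_least h₁ne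
  by_cases h2 : N₁ (i + 2)
  · have hip := h₁lt _ h2
    have h₂eq : p + b < n → ∀ k, N₂ k ↔ k = i + 1 := by
      intro hpn
      obtain ⟨⟨k₀, hk₀⟩, h₂lt, hcut⟩ := h₂ hpn
      have key : ∀ k, N₂ k → k = i + 1 := fun k hk =>
        (hcut (i + 1) (by omega) (by omega) (by omega) (by omega) (by omega)).eq_of_second_path hpn
          hb (Nat.lt_succ_self i) (Nat.lt_succ_self _) hip hi₁ h2 (h₂lt k hk) hk
      exact fun k => ⟨key k, fun hk => hk ▸ key k₀ hk₀ ▸ hk₀⟩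
    have h' : HasModel G n (threePaths p b N₁ (fun k => k = i + 1)) :=
      h.congr (threePaths_congr rfl rfl (fun _ _ _ => Iff.rfl) fun hpn k _ => h₂eq hpn k)
    obtain ⟨t, ht, hti⟩ : ∃ t ≤ 1, (N₁ (i + 1) ↔ t = 1) := by
      by_cases hN : N₁ (i + 1)
      · exact ⟨1, le_rfl, by simpa using hN⟩
      · exact ⟨0, zero_le_one, by simpa using hN⟩
    refine isListed_of_third_around (i := i + 1) ht
      ((h'.swap_paths hpb h₁lt (by intros; omega)).congr (threePaths_congr rfl rfl ?_ ?_))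
      (by omega) (by omega) (by omega)
    · intros; omega
    · intro _ k hk
      constructor
      · intro hk₁
        have h3 := hi k hk₁
        have h4 := hwin i k hi₁ hk₁
        rcases eq_or_ne k (i + 1) with rfl | h5
        · exact Or.inr (Or.inr ⟨rfl, hti.1 hk₁⟩)
        · omega
      · rintro (h3 | h3 | ⟨rfl, h3⟩)
        · obtain rfl : k = i := by omega
          exact hi₁
        · obtain rfl : k = i + 2 := by omega
          exact h2
        · exact hti.2 h3
  · obtain ⟨e, he, hie, hiff⟩ := exists_interval_of_le_succ hi₁ hi (fun k hk => by
      have h3 := hwin i k hi₁ hk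
      have h4 : k ≠ i + 2 := by rintro rfl; exact h2 hk
      omega)
    obtain rfl : N₁ = fun k => i ≤ k ∧ k ≤ i + e := funext fun k => propext (hiff k)
    exact isListed_of_model_of_le_one he h hpb hb (h₁lt _ hie) h₂

end

/-! ### The listed graphs have four vertices spanning only the whole graph -/

/-- If each label outside a set of at most four labels separates two labels of this set, then the
vertices carrying the labels of this set lie in no proper connected vertex set. -/
theorem exists_card_four_of_hasModel {V : Type*} [Fintype V] {G : SimpleGraph V} {n : ℕ}
    (hn : Fintype.card V = n) (hn4 : 4 ≤ n) {D : ℕ → ℕ → Prop} (h : HasModel G n D)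
    {T : Finset ℕ} (hT : T.card ≤ 4)
    (hcut : ∀ x < n, x ∉ T → ∃ c : ℕ → Prop,
      (∀ i j, i < j → j < n → i ≠ x → j ≠ x → D i j → (c i ↔ c j)) ∧
        ∃ i ∈ T, ∃ j ∈ T, i < n ∧ j < n ∧ c i ∧ ¬ c j) :
    ∃ S : Finset V, S.card = 4 ∧
      ∀ W : Set V, (S : Set V) ⊆ W → (G.induce W).Preconnected → W = Set.univ := by
  classical
  obtain ⟨f, f_inj, f_lt, f_surj, f_adj⟩ := h
  obtain ⟨S, hTS, hS4⟩ := Finset.exists_superset_card_eq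
    (s := Finset.univ.filter fun v => f v ∈ T) (n := 4)
    ((Finset.card_le_card_of_injOn f (fun v hv => by simpa using hv) f_inj.injOn).trans hT)
    (by rwa [hn])
  refine ⟨S, hS4, fun W hSW hW => Set.eq_univ_of_forall fun v => ?_⟩
  have hmem : ∀ u, f u ∈ T → u ∈ W := fun u hu => hSW (hTS (by simpa using hu))
  by_contra hv
  obtain ⟨c, hc, i, hi, j, hj, hin, hjn, hci, hcj⟩ := hcut (f v) (f_lt v) (fun h => hv (hmem v h))
  obtain ⟨u, rfl⟩ := f_surj i hin
  obtain ⟨w, rfl⟩ := f_surj j hjn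
  refine hcj (hW.induce_prop (c := fun y => c (f y)) ?_ (hmem u hi) (hmem w hj) hci)
  intro y hy z hz hyz
  have hyv : f y ≠ f v := fun h => hv (f_inj h ▸ hy)
  have hzv : f z ≠ f v := fun h => hv (f_inj h ▸ hz)
  rcases lt_trichotomy (f y) (f z) with h | h | h
  · exact (hc _ _ h (f_lt z) hyv hzv ((f_adj y z h).1 hyz)).1
  · exact absurd (f_inj h) hyz.ne
  · exact (hc _ _ h (f_lt y) hzv hyv ((f_adj z y h).1 hyz.symm)).2

/-- The four vertices are the ends of the three paths. `N₁` and `N₂` are only bounded from above,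
since they are irrelevant when the path in question is empty. -/
theorem exists_card_four_of_dumbbell {V : Type*} [Fintype V] {G : SimpleGraph V} {n : ℕ}
    (hn : Fintype.card V = n) (hn4 : 4 ≤ n) {p b a q e₁ e₂ : ℕ} {N₁ N₂ : ℕ → Prop}
    (h : HasModel G n (threePaths p b N₁ N₂)) (hN₁ : ∀ k, N₁ k → a ≤ k ∧ k ≤ a + e₁)
    (hN₂ : ∀ k, N₂ k → q ≤ k + e₂ ∧ k ≤ q) (he₁ : e₁ ≤ 1) (he₂ : e₂ ≤ 1)
    (haq : a + e₁ + e₂ ≤ q) (hq : q < p) (hpb : p + b ≤ n) :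
    ∃ S : Finset V, S.card = 4 ∧
      ∀ W : Set V, (S : Set V) ⊆ W → (G.induce W).Preconnected → W = Set.univ := by
  refine exists_card_four_of_hasModel hn hn4 h (T := {0, p - 1, p + b - 1, n - 1})
    Finset.card_le_four fun x hx hxT => ?_
  simp only [Finset.mem_insert, Finset.mem_singleton, not_or] at hxT
  rcases lt_or_ge x p with hxp | hxp
  · -- The left side of a vertex `x` of the first path. For `a < x` the second path still hangs on
    -- `a`, otherwise on some vertex to the right of `x`; similarly for the third path.
    refine ⟨fun k => k < x ∨ p ≤ k ∧ k < p + b ∧ a < x ∨ p + b ≤ k ∧ q ≤ x, ?_,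
      0, by simp, p - 1, by simp, by omega, by omega, by omega, by omega⟩
    intro i j hij hj hix hjx hD
    unfold threePaths at hD
    split_ifs at hD with h1 h2
    · have := hN₁ i hD
      omega
    · have := hN₂ i hD
      omega
    · omega
  · rcases lt_or_ge x (p + b) with hxb | hxb
    · refine ⟨fun k => x < k ∧ k < p + b, ?_, p + b - 1, by simp, 0, by simp, by omega, by omega,
        by omega, by omega⟩
      intro i j hij hj hix hjx hD
      unfold threePaths at hD
      split_ifs at hD with h1 h2
      · have := hN₁ i hD
        omega
      · have := hN₂ i hD
        omega
      · omega
    · refine ⟨fun k => x < k, ?_, n - 1, by simp, 0, by simp, by omega, by omega,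
        by omega, by omega⟩
      intro i j hij hj hix hjx hD
      unfold threePaths at hD
      split_ifs at hD with h1 h2
      · have := hN₁ i hD
        omega
      · have := hN₂ i hD
        omega
      · omega

theorem exists_card_four_of_fourPaths {V : Type*} [Fintype V] {G : SimpleGraph V} {n : ℕ}
    (hn : Fintype.card V = n) (hn4 : 4 ≤ n) {H : SimpleGraph (Fin 4)} {a b c d : ℕ}
    (habcd : a + b + c + d + 4 = n) (h : HasModel G n (fourPathsModel H a b c)) :
    ∃ S : Finset V, S.card = 4 ∧
      ∀ W : Set V, (S : Set V) ⊆ W → (G.induce W).Preconnected → W = Set.univ := by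
  refine exists_card_four_of_hasModel hn hn4 h
    (T := {a, a + b + 1, a + b + c + 2, n - 1}) Finset.card_le_four fun x hx hxT => ?_
  simp only [Finset.mem_insert, Finset.mem_singleton, not_or] at hxT
  obtain ⟨l, m, -, hm, hmT, hlT, h₁, h₂, h₃, hx'⟩ : ∃ l m, l ≤ m ∧ m < n ∧
      (m = a ∨ m = a + b + 1 ∨ m = a + b + c + 2 ∨ m = n - 1) ∧
      (l = 0 ∨ l = a + 1 ∨ l = a + b + 2 ∨ l = a + b + c + 3) ∧
      (m = a ↔ l = 0) ∧ (m = a + b + 1 ↔ l = a + 1) ∧ (m = a + b + c + 2 ↔ l = a + b + 2) ∧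
      (l ≤ x ∧ x < m) := by
    rcases lt_or_ge x a with h1 | h1
    · exact ⟨0, a, by omega⟩
    · rcases lt_or_ge x (a + b + 1) with h2 | h2
      · exact ⟨a + 1, a + b + 1, by omega⟩
      · rcases lt_or_ge x (a + b + c + 2) with h3 | h3
        · exact ⟨a + b + 2, a + b + c + 2, by omega⟩
        · exact ⟨a + b + c + 3, n - 1, by omega⟩
  refine ⟨fun k => x < k ∧ k ≤ m, ?_, m, by simpa using hmT, if m = a then n - 1 else a, ?_, hm,
    ?_, by omega, ?_⟩
  · intro i j hij hj hix hjx hD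
    unfold fourPathsModel at hD
    split_ifs at hD <;> omega
  · split_ifs <;> simp
  · split_ifs <;> omega
  · split_ifs <;> omega

theorem IsListed.exists_card_four {V : Type*} [Fintype V] {G : SimpleGraph V} {n : ℕ}
    (hn : Fintype.card V = n) (hn4 : 4 ≤ n) (h : IsListed G n) :
    ∃ S : Finset V, S.card = 4 ∧
      ∀ W : Set V, (S : Set V) ⊆ W → (G.induce W).Preconnected → W = Set.univ := by
  rcases h with ⟨a, b, c, d, h, ⟨e⟩⟩ | ⟨a, b, c, d, h, ⟨e⟩⟩ | ⟨a, b, c, d, h, ⟨e⟩⟩ |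
    ⟨a, b, c, d, rfl, ⟨e⟩⟩ | ⟨a, b, c, d, rfl, ⟨e⟩⟩ | ⟨a, b, c, d, rfl, ⟨e⟩⟩
  · exact exists_card_four_of_dumbbell hn hn4 ((treeGraph_hasModel n a b c d h).of_iso e)
      (a := a) (e₁ := 0) (q := n - b - c - d - 1) (e₂ := 0) (by intros; omega) (by intros; omega)
      (by omega) (by omega) (by omega) (by omega) (by omega)
  · exact exists_card_four_of_dumbbell hn hn4 ((triangleGraph_hasModel n a b c d h).of_iso e)
      (a := a) (e₁ := 1) (q := n - b - c - d - 2) (e₂ := 0) (by intros; omega) (by intros; omega)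
      (by omega) (by omega) (by omega) (by omega) (by omega)
  · exact exists_card_four_of_dumbbell hn hn4 ((triangleGraph'_hasModel n a b c d h).of_iso e)
      (a := a) (e₁ := 1) (q := n - b - c - d - 3) (e₂ := 1) (by intros; omega) (by intros; omega)
      (by omega) (by omega) (by omega) (by omega) (by omega)
  all_goals
    exact exists_card_four_of_fourPaths hn hn4 rfl ((fourPaths_hasModel _ a b c d).of_iso e)

theorem theorem4 {V : Type*} [Fintype V] (G : SimpleGraph V) (hG : G.Connected)
    (n : ℕ) (hcard : Fintype.card V = n) (hn : 5 ≤ n) :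
    sdiam G 4 = ((n - 1 : ℕ) : ℕ∞) ↔
      (∃ (a b c d : ℕ) (h : a + b + c + d + 1 ≤ n), Nonempty (G ≃g treeGraph n a b c d h)) ∨
      (∃ (a b c d : ℕ) (h : a + b + c + d + 3 ≤ n), Nonempty (G ≃g triangleGraph n a b c d h)) ∨
      (∃ (a b c d : ℕ) (h : a + b + c + d + 5 ≤ n), Nonempty (G ≃g triangleGraph' n a b c d h)) ∨
      (∃ a b c d : ℕ, a + b + c + d + 4 = n ∧
        Nonempty (G ≃g fourPaths (⊤ : SimpleGraph (Fin 4)) a b c d)) ∨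
      (∃ a b c d : ℕ, a + b + c + d + 4 = n ∧
        Nonempty (G ≃g fourPaths (SimpleGraph.cycleGraph 4) a b c d)) ∨
      (∃ a b c d : ℕ, a + b + c + d + 4 = n ∧
        Nonempty (G ≃g fourPaths K4minus a b c d)) := by
  have h := sdiam_eq_iff hG (k := 4) (by omega) (by omega)
  rw [hcard] at h
  refine h.trans ⟨fun ⟨S, hS4, hS⟩ => ?_, fun h => IsListed.exists_card_four hcard (by omega) h⟩
  obtain ⟨p, b, N₁, N₂, hmodel, hp, hpb, h₁, hb, h₂⟩ := exists_threePaths_model hG hcard hS4 hS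
  exact isListed_of_model hmodel hp hpb h₁ hb h₂
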